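/- Let $f:\{0,1\}^n\to\{0,1\}$ be a Boolean function that is onto $\{0,1\}$ (i.e. nonconstant). Then $f$ has a tree decomposition, and it is unique up to double-negation (and up to the order in which the children of a vertex are listed): if $T$ and $Z$ are tree decompositions of $f$, then $T$ can be transformed into $Z$ by finitely many double-negations. The terms are as follows. A *distinct variable tree* is a finite rooted tree in which every leaf is labeled with a literal ($x_i$ or $\neg x_i$), different leaves carrying different variables, and in which every non-leaf vertex has $k\ge 2$ children and is labeled with a Boolean function of $k$ variables, one for each child, that depends on all of them. It represents a Boolean function in the obvious way. It is called *nontrivial* if it has more than one non-leaf vertex. Write $(\neg)g$ for "$g$ or its negation". A *tree decomposition* of $f$ is a distinct variable tree representing $f$ such that: (i) no non-leaf vertex is labeled with a function that can be represented by a nontrivial distinct variable tree, unless that function is $(\neg)\mathrm{AND}_k$, $(\neg)\mathrm{OR}_k$ or $(\neg)\mathrm{XOR}_k$ for some $k$; (ii) no vertex labeled $(\neg)\mathrm{AND}_k$ has a child labeled $\mathrm{AND}_l$ or $\neg\mathrm{OR}_l$; (iii) no vertex labeled $(\neg)\mathrm{OR}_k$ has a child labeled $\mathrm{OR}_l$ or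 $\neg\mathrm{AND}_l$; (iv) no vertex labeled $(\neg)\mathrm{XOR}_k$ has a child labeled $(\neg)\mathrm{XOR}_l$; (v) every non-leaf vertex labeled with a function that is constant on all but one input is labeled with $(\neg)\mathrm{AND}_k$ or $(\neg)\mathrm{OR}_k$. A *double-negation* negates the output of some non-root vertex $v$ (for a non-leaf vertex this negates its label; for a leaf it exchanges $x_i$ and $\neg x_i$) and the corresponding input of the label of $v$'s parent. The intermediate trees in a chain of double-negations are only required to be trees, not tree decompositions. -/

import Mathlib

/-- Finite rooted trees. A leaf carries a literal: the variable `x` if `neg = false`, its negation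
if `neg = true`. A non-leaf vertex carries a Boolean function with one argument per child. -/
inductive BoolTree (V : Type) : Type
  | leaf (x : V) (neg : Bool) : BoolTree V
  | node (k : ℕ) (g : (Fin k → Bool) → Bool) (c : Fin k → BoolTree V) : BoolTree V

/-- The Boolean function `g` depends on its `i`-th argument. -/
def DependsOnArg {k : ℕ} (g : (Fin k → Bool) → Bool) (i : Fin k) : Prop :=
  ∃ y : Fin k → Bool, g (Function.update y i true) ≠ g (Function.update y i false)

/-- `AND_k`. -/
def andFn (k : ℕ) (y : Fin k → Bool) : Bool := decide (∀ i, y i = true)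

/-- `OR_k`. -/
def orFn (k : ℕ) (y : Fin k → Bool) : Bool := decide (∃ i, y i = true)

/-- `XOR_k`. -/
def xorFn (k : ℕ) (y : Fin k → Bool) : Bool :=
  decide (Odd (Finset.univ.filter (fun i => y i = true)).card)

/-- The negation of a Boolean function. -/
def notFn {k : ℕ} (g : (Fin k → Bool) → Bool) (y : Fin k → Bool) : Bool := !(g y)

/-- `g` is `AND_k` or its negation. -/
def IsAndLabel {k : ℕ} (g : (Fin k → Bool) → Bool) : Prop := g = andFn k ∨ g = notFn (andFn k)

/-- `g` is `OR_k` or its negation. -/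
def IsOrLabel {k : ℕ} (g : (Fin k → Bool) → Bool) : Prop := g = orFn k ∨ g = notFn (orFn k)

/-- `g` is `XOR_k` or its negation. -/
def IsXorLabel {k : ℕ} (g : (Fin k → Bool) → Bool) : Prop := g = xorFn k ∨ g = notFn (xorFn k)

/-- `g` is constant on all but one input. -/
def ConstantButOne {k : ℕ} (g : (Fin k → Bool) → Bool) : Prop :=
  ∃ (y₀ : Fin k → Bool) (b : Bool), ∀ y, y ≠ y₀ → g y = b

namespace BoolTree

variable {V : Type}

/-- The value of the tree on an assignment of the variables. -/
def eval (x : V → Bool) : BoolTree V → Bool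
  | leaf v neg => xor neg (x v)
  | node _ g c => g (fun i => (c i).eval x)

/-- The set of variables at the leaves. -/
def vars : BoolTree V → Set V
  | leaf v _ => {v}
  | node _ _ c => ⋃ i, (c i).vars

/-- The number of non-leaf vertices. -/
def numInner : BoolTree V → ℕ
  | leaf _ _ => 0
  | node _ _ c => 1 + ∑ i, (c i).numInner

/-- Distinct variable trees: different leaves carry different variables, every non-leaf vertex has
at least two children, and its label depends on all of its arguments. -/
def IsDistinctVariable : BoolTree V → Prop
  | leaf _ _ => True
  | node k g c =>
      2 ≤ k ∧ (∀ i, DependsOnArg g i) ∧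
      (∀ i j, i ≠ j → Disjoint (c i).vars (c j).vars) ∧
      ∀ i, (c i).IsDistinctVariable

/-- `IsSubtree s t`: `s` is the full subtree of `t` below some vertex of `t`. -/
inductive IsSubtree : BoolTree V → BoolTree V → Prop
  | refl (t : BoolTree V) : IsSubtree t t
  | child {s : BoolTree V} {k : ℕ} (g : (Fin k → Bool) → Bool) (c : Fin k → BoolTree V)
      (i : Fin k) (h : IsSubtree s (c i)) : IsSubtree s (node k g c)

/-- Negate the output of the root vertex. -/
def negRoot : BoolTree V → BoolTree V
  | leaf v neg => leaf v (!neg)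
  | node k g c => node k (notFn g) c

/-- `DoubleNeg s t`: `t` arises from `s` by one double-negation, i.e. by negating the output of one
non-root vertex and the corresponding argument of the label of its parent. -/
inductive DoubleNeg : BoolTree V → BoolTree V → Prop
  | atRoot {k : ℕ} (g : (Fin k → Bool) → Bool) (c : Fin k → BoolTree V) (i : Fin k) :
      DoubleNeg (node k g c)
        (node k (fun y => g (Function.update y i (!(y i))))
          (Function.update c i (c i).negRoot))
  | inChild {k : ℕ} (g : (Fin k → Bool) → Bool) (c : Fin k → BoolTree V) (i : Fin k)
      {t : BoolTree V} (h : DoubleNeg (c i) t) :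
      DoubleNeg (node k g c) (node k g (Function.update c i t))

/-- Equality of trees whose children are unordered: at every vertex the children may be listed in
another order if the arguments of the label are permuted accordingly. -/
inductive SameTree : BoolTree V → BoolTree V → Prop
  | leaf (v : V) (neg : Bool) : SameTree (leaf v neg) (leaf v neg)
  | node {k : ℕ} (σ : Equiv.Perm (Fin k)) (g g' : (Fin k → Bool) → Bool)
      (c c' : Fin k → BoolTree V) (hg : ∀ y, g' y = g (fun i => y (σ i)))
      (hc : ∀ i, SameTree (c i) (c' (σ i))) : SameTree (node k g c) (node k g' c')

end BoolTree

/-- `g` is represented by a distinct variable tree with more than one non-leaf vertex. -/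
def HasNontrivialTree {k : ℕ} (g : (Fin k → Bool) → Bool) : Prop :=
  ∃ T : BoolTree (Fin k), T.IsDistinctVariable ∧ 2 ≤ T.numInner ∧ ∀ y, T.eval y = g y

/-- `T` is a tree decomposition of `f`. -/
structure IsTreeDecomposition {V : Type} (T : BoolTree V) (f : (V → Bool) → Bool) : Prop where
  distinctVariable : T.IsDistinctVariable
  represents : ∀ x, T.eval x = f x
  indecomposable : ∀ (k : ℕ) (g : (Fin k → Bool) → Bool) (c : Fin k → BoolTree V),
    (BoolTree.node k g c).IsSubtree T → HasNontrivialTree g →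
      IsAndLabel g ∨ IsOrLabel g ∨ IsXorLabel g
  and_child : ∀ (k : ℕ) (g : (Fin k → Bool) → Bool) (c : Fin k → BoolTree V),
    (BoolTree.node k g c).IsSubtree T → IsAndLabel g →
      ∀ (i : Fin k) (l : ℕ) (h : (Fin l → Bool) → Bool) (d : Fin l → BoolTree V),
        c i = BoolTree.node l h d → h ≠ andFn l ∧ h ≠ notFn (orFn l)
  or_child : ∀ (k : ℕ) (g : (Fin k → Bool) → Bool) (c : Fin k → BoolTree V),
    (BoolTree.node k g c).IsSubtree T → IsOrLabel g →
      ∀ (i : Fin k) (l : ℕ) (h : (Fin l → Bool) → Bool) (d : Fin l → BoolTree V),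
        c i = BoolTree.node l h d → h ≠ orFn l ∧ h ≠ notFn (andFn l)
  xor_child : ∀ (k : ℕ) (g : (Fin k → Bool) → Bool) (c : Fin k → BoolTree V),
    (BoolTree.node k g c).IsSubtree T → IsXorLabel g →
      ∀ (i : Fin k) (l : ℕ) (h : (Fin l → Bool) → Bool) (d : Fin l → BoolTree V),
        c i = BoolTree.node l h d → ¬ IsXorLabel h
  constantButOne : ∀ (k : ℕ) (g : (Fin k → Bool) → Bool) (c : Fin k → BoolTree V),
    (BoolTree.node k g c).IsSubtree T → ConstantButOne g → IsAndLabel g ∨ IsOrLabel g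

/-!
A splitting of a Boolean function `f` under an operation `op` (conjunction, disjunction or parity)
writes `f` as `op` applied to two nonconstant functions without common variables. Two facts about
splittings carry the proof. `f` splits under at most one operation (`IsSplit.op_unique`): there are
two variables which both splittings separate, and after restricting all the other variables the two
operations describe the same function of these two. And two splittings under the same operation
have a common refinement (`IsSplit.exists_split_left`).

A vertex labeled `(¬)AND`, `(¬)OR` or `(¬)XOR` splits off each of its children, possibly negated.
All other labels in a tree decomposition are indecomposable and have at least three arguments,
because a function that depends on both of two arguments is `(¬)XOR` or constant on all but one
input. A set of variables is bound in `f` if it influences `f` through one bit only. Below an indecomposable label,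
every proper bound set lies in the block of variables of a single child
(`IsComp.exists_subset_of_isBound`): otherwise, restricting each child to one suitable variable
would give a bound set of the label with at least two elements but not all, hence a nontrivial tree
for the label. It follows that the root of every tree decomposition of `f` performs `op` as soon as
`f` splits under `op` (`IsTreeDecomposition.hasRootOp`), as both parts are bound sets.

For uniqueness, let two tree decompositions of `f` be given. Each block of the first root lies in a
block of the second (`IsTreeDecomposition.exists_vars_subset`): blocks are bound sets, which settles
the case of an indecomposable label; if the second root performs `op`, then so does the first, and a
block that meets two blocks of the second root would make the child itself split under `op`, so that
its root performs `op` too, which the conditions on children exclude. Hence the blocks coincide, the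
children represent the same functions up to negation, and double-negations at the root together with
induction on the tree transform one decomposition into the other.

Existence is proved by induction on the number of essential variables. If `f` splits under `op`,
take a splitting with a minimal first part `a`. Then `a` does not split under `op`, and its
decomposition can be attached as a new child to that of the second part, or joined with it under a
new root (`IsSplit.exists_isTreeDecomposition`). If `f` does not split, write it as a composition
over disjoint blocks with the least number, at least two, of blocks; by minimality the outer
function is indecomposable (`IsComp.exists_lt`), and it serves as the label of the root.
-/

/-! ### Essential variables -/

section Essential

variable {V : Type} [DecidableEq V]

/-- The set of essential variables of a Boolean function, i.e. of those on which its value really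
depends. A function of finitely many variables is nonconstant iff this set is nonempty, and
nonconstancy is expressed in this form throughout. -/
def ess (F : (V → Bool) → Bool) : Set V :=
  {v | ∃ x, F (Function.update x v true) ≠ F (Function.update x v false)}

theorem update_of_notMem_ess {F : (V → Bool) → Bool} {v : V} (h : v ∉ ess F) (x : V → Bool)
    (b : Bool) : F (Function.update x v b) = F x := by
  have h' : ∀ x, F (Function.update x v true) = F (Function.update x v false) := by
    simpa [ess] using h
  have key : ∀ b b', F (Function.update x v b) = F (Function.update x v b') := by
    intro b b'; cases b <;> cases b' <;> simp [h']
  simpa using key b (x v)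

theorem ess_subset_of_dependsOn {F : (V → Bool) → Bool} {A : Set V} (h : DependsOn F A) :
    ess F ⊆ A := by
  rintro v ⟨x, hx⟩
  by_contra hv
  refine hx (h fun i hi => ?_)
  have : i ≠ v := by rintro rfl; exact hv hi
  simp [this]

theorem dependsOn_ess [Finite V] (F : (V → Bool) → Bool) : DependsOn F (ess F) := by
  intro x y hxy
  cases nonempty_fintype V
  have key : ∀ S : Finset V, F (fun v => if v ∈ S then y v else x v) = F x := by
    intro S
    induction S using Finset.induction_on with
    | empty => simp
    | insert a S ha ih =>
      have h1 : (fun v => if v ∈ insert a S then y v else x v)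
          = Function.update (fun v => if v ∈ S then y v else x v) a (y a) := by
        funext v
        by_cases hv : v = a
        · subst hv; simp
        · simp [hv]
      rw [h1, ← ih]
      by_cases hae : a ∈ ess F
      · rw [← hxy a hae]
        congr 1
        funext v
        by_cases hv : v = a
        · subst hv; simp [ha]
        · simp [hv]
      · exact update_of_notMem_ess hae _ _
  simpa using (key Finset.univ).symm

theorem exists_eq_of_ess_nonempty {F : (V → Bool) → Bool} (h : (ess F).Nonempty) (b : Bool) :
    ∃ x, F x = b := by
  obtain ⟨v, x, hx⟩ := h
  by_cases h1 : F (Function.update x v true) = b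
  · exact ⟨_, h1⟩
  · refine ⟨Function.update x v false, ?_⟩
    revert hx h1
    cases F (Function.update x v true) <;> cases F (Function.update x v false) <;> cases b <;> simp

theorem ess_nonempty_of_ne [Finite V] {F : (V → Bool) → Bool} {x y : V → Bool} (h : F x ≠ F y) :
    (ess F).Nonempty := by
  by_contra hne
  rw [Set.not_nonempty_iff_eq_empty] at hne
  exact h (dependsOn_ess F fun i hi => by simp [hne] at hi)

theorem ess_xor (F : (V → Bool) → Bool) (s : Bool) : ess (fun x => xor (F x) s) = ess F := by
  cases s <;> simp [ess]

theorem ess_literal (v : V) (s : Bool) : ess (fun x : V → Bool => xor s (x v)) = {v} := by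
  apply Set.Subset.antisymm
  · exact ess_subset_of_dependsOn fun x y h => by simp [h v rfl]
  · rintro w rfl
    exact ⟨fun _ => false, by cases s <;> simp⟩

end Essential

/-- Assignments prescribed on disjoint blocks of variables have a common extension. -/
theorem exists_glue {V ι : Type} (C : ι → Set V) (hC : ∀ i j, i ≠ j → Disjoint (C i) (C j))
    (xs : ι → V → Bool) : ∃ x : V → Bool, ∀ i, ∀ v ∈ C i, x v = xs i v := by
  classical
  refine ⟨fun v => if h : ∃ i, v ∈ C i then xs h.choose v else false, fun i v hv => ?_⟩
  have h : ∃ i, v ∈ C i := ⟨i, hv⟩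
  have : h.choose = i := by
    by_contra hne
    exact Set.disjoint_left.1 (hC _ _ hne) h.choose_spec hv
  simp only [dif_pos h, this]

/-! ### Splitting a function into two independent parts -/

/-- The three associative commutative operations on bits that can occur in a chain of vertices. -/
inductive BoolOp : Type
  | conj : BoolOp
  | disj : BoolOp
  | parity : BoolOp

namespace BoolOp

/-- The binary operation. -/
def apply : BoolOp → Bool → Bool → Bool
  | conj => and
  | disj => or
  | parity => xor

/-- The neutral element. -/
def ident : BoolOp → Bool
  | conj => true
  | disj => false
  | parity => false

instance (op : BoolOp) : Std.Commutative op.apply where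
  comm a b := by cases op <;> cases a <;> cases b <;> rfl

instance (op : BoolOp) : Std.Associative op.apply where
  assoc a b c := by cases op <;> cases a <;> cases b <;> cases c <;> rfl

theorem apply_comm (op : BoolOp) (a b : Bool) : op.apply a b = op.apply b a :=
  Std.Commutative.comm a b

theorem apply_assoc (op : BoolOp) (a b c : Bool) :
    op.apply (op.apply a b) c = op.apply a (op.apply b c) :=
  Std.Associative.assoc a b c

theorem apply_ident (op : BoolOp) (a : Bool) : op.apply a op.ident = a := by
  cases op <;> cases a <;> rfl

/-- The operation can be read off from any one of its two-variable restrictions. -/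
theorem eq_of_apply_eq {op op' : BoolOp} {α β α' β' : Bool → Bool} (hα : α true ≠ α false)
    (hβ : β true ≠ β false) (h : ∀ p q, op.apply (α p) (β q) = op'.apply (α' p) (β' q)) :
    op = op' := by
  have h1 := h true true
  have h2 := h true false
  have h3 := h false true
  have h4 := h false false
  clear h
  revert hα hβ h1 h2 h3 h4
  generalize α true = a1
  generalize α false = a0
  generalize β true = b1
  generalize β false = b0
  generalize α' true = c1
  generalize α' false = c0
  generalize β' true = d1
  generalize β' false = d0
  cases op <;> cases op' <;> simp only [apply, reduceCtorEq] <;> revert a1 a0 b1 b0 c1 c0 d1 d0 <;>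
    decide

end BoolOp

section Split

variable {V : Type} [DecidableEq V]

/-- `f` is obtained by applying `op` to two nonconstant functions without common variables. -/
structure IsSplit (op : BoolOp) (f a b : (V → Bool) → Bool) : Prop where
  eq : ∀ x, f x = op.apply (a x) (b x)
  disj : Disjoint (ess a) (ess b)
  left : (ess a).Nonempty
  right : (ess b).Nonempty

theorem mem_ess_or_of_eq_apply {op : BoolOp} {f a b : (V → Bool) → Bool}
    (h : ∀ x, f x = op.apply (a x) (b x)) {v : V} (hv : v ∈ ess f) : v ∈ ess a ∨ v ∈ ess b := by
  by_contra! hab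
  obtain ⟨x, hx⟩ := hv
  exact hx (by simp only [h, update_of_notMem_ess hab.1, update_of_notMem_ess hab.2])

namespace IsSplit

variable {op op' : BoolOp} {f a b a' b' : (V → Bool) → Bool}

theorem symm (h : IsSplit op f a b) : IsSplit op f b a :=
  ⟨fun x => by rw [h.eq, BoolOp.apply_comm], h.disj.symm, h.right, h.left⟩

variable [Finite V]

theorem left_subset (h : IsSplit op f a b) : ess a ⊆ ess f := by
  classical
  rintro v hv
  have hvb : v ∉ ess b := Set.disjoint_left.1 h.disj hv
  obtain ⟨x, hx⟩ := hv
  obtain ⟨x', hx'⟩ := exists_eq_of_ess_nonempty h.right op.ident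
  have ha : ∀ p, a (Function.update ((ess a).piecewise x x') v p) = a (Function.update x v p) := by
    intro p
    refine dependsOn_ess a fun i hi => ?_
    by_cases hiv : i = v
    · subst hiv; simp
    · simp [hiv, hi]
  have hb : b ((ess a).piecewise x x') = op.ident := by
    rw [← hx']
    exact dependsOn_ess b fun i hi => by simp [Set.disjoint_right.1 h.disj hi]
  refine ⟨(ess a).piecewise x x', ?_⟩
  simpa only [h.eq, ha, update_of_notMem_ess hvb, hb, BoolOp.apply_ident] using hx

theorem ess_eq (h : IsSplit op f a b) : ess f = ess a ∪ ess b :=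
  Set.Subset.antisymm (fun _ hv => mem_ess_or_of_eq_apply h.eq hv)
    (Set.union_subset h.left_subset h.symm.left_subset)

theorem op_unique_of_mem (h : IsSplit op f a b) (h' : IsSplit op' f a' b') {u w : V}
    (hua : u ∈ ess a) (hua' : u ∈ ess a') (hwb : w ∈ ess b) (hwb' : w ∈ ess b') : op = op' := by
  classical
  have hub : u ∉ ess b := Set.disjoint_left.1 h.disj hua
  have hub' : u ∉ ess b' := Set.disjoint_left.1 h'.disj hua'
  have hwa : w ∉ ess a := Set.disjoint_right.1 h.disj hwb
  have hwa' : w ∉ ess a' := Set.disjoint_right.1 h'.disj hwb'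
  have huw : u ≠ w := by rintro rfl; exact hub hwb
  obtain ⟨x, hx⟩ := hua
  obtain ⟨y, hy⟩ := hwb
  set z := (ess a).piecewise x y with hz
  refine BoolOp.eq_of_apply_eq (α := fun p => a (Function.update x u p))
    (β := fun q => b (Function.update y w q)) (α' := fun p => a' (Function.update z u p))
    (β' := fun q => b' (Function.update z w q)) hx hy fun p q => ?_
  have h1 := h.eq (Function.update (Function.update z u p) w q)
  rw [h'.eq] at h1
  rw [update_of_notMem_ess hwa', update_of_notMem_ess hwa] at h1
  rw [Function.update_comm huw, update_of_notMem_ess hub', update_of_notMem_ess hub] at h1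
  have e1 : a (Function.update z u p) = a (Function.update x u p) := by
    refine dependsOn_ess a fun i hi => ?_
    by_cases hiu : i = u
    · subst hiu; simp
    · simp [hiu, hz, hi]
  have e2 : b (Function.update z w q) = b (Function.update y w q) := by
    refine dependsOn_ess b fun i hi => ?_
    by_cases hiw : i = w
    · subst hiw; simp
    · simp [hiw, hz, Set.disjoint_right.1 h.disj hi]
  rw [e1, e2] at h1
  exact h1.symm

/-- A function splits under at most one operation: two variables separated by both splittings
exist, and restricting all other variables turns both operations into functions of these two. -/
theorem op_unique (h : IsSplit op f a b) (h' : IsSplit op' f a' b') : op = op' := by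
  have hE : ∀ v, (v ∈ ess a ∨ v ∈ ess b) ↔ (v ∈ ess a' ∨ v ∈ ess b') := by
    intro v
    have := h.ess_eq.symm.trans h'.ess_eq
    exact Set.ext_iff.1 this v
  obtain ⟨p, hp⟩ := h.left
  obtain ⟨q, hq⟩ := h.right
  obtain ⟨p', hp'⟩ := h'.left
  obtain ⟨q', hq'⟩ := h'.right
  have key1 := @op_unique_of_mem V _ op op' f a b a' b' _ h h'
  have key2 := @op_unique_of_mem V _ op op' f a b b' a' _ h h'.symm
  have hp2 := (hE p).1 (Or.inl hp)
  have hq2 := (hE q).1 (Or.inr hq)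
  have hp3 := (hE p').2 (Or.inl hp')
  have hq3 := (hE q').2 (Or.inr hq')
  grind

/-- Two splittings under the same operation have a common refinement. -/
theorem exists_split_left (h : IsSplit op f a b) (h' : IsSplit op f a' b')
    (hne : (ess a ∩ ess a').Nonempty) (hns : ¬ ess a ⊆ ess a') : ∃ p q, IsSplit op a p q := by
  classical
  -- Fixing the variables of `b` at a point where `b` is neutral turns `f` into `a`.
  obtain ⟨e, he⟩ := exists_eq_of_ess_nonempty h.right op.ident
  set R : (V → Bool) → (V → Bool) := fun x => (ess a).piecewise x e with hR
  have hRdep : ∀ (F : (V → Bool) → Bool), DependsOn (fun x => F (R x)) (ess F) := by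
    intro F x y hxy
    refine dependsOn_ess F fun i hi => ?_
    by_cases hia : i ∈ ess a
    · simp [hR, hia, hxy i hi]
    · simp [hR, hia]
  have heq : ∀ x, a x = op.apply (a' (R x)) (b' (R x)) := by
    intro x
    rw [← h'.eq, h.eq]
    have h1 : a (R x) = a x := dependsOn_ess a fun i hi => by simp [hR, hi]
    have h2 : b (R x) = b e :=
      dependsOn_ess b fun i hi => by simp [hR, Set.disjoint_right.1 h.disj hi]
    rw [h1, h2, he, BoolOp.apply_ident]
  have hp := ess_subset_of_dependsOn (hRdep a')
  have hq := ess_subset_of_dependsOn (hRdep b')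
  refine ⟨fun x => a' (R x), fun x => b' (R x), heq, h'.disj.mono hp hq, ?_, ?_⟩
  · obtain ⟨v, hva, hva'⟩ := hne
    rcases mem_ess_or_of_eq_apply heq hva with h1 | h1
    · exact ⟨v, h1⟩
    · exact absurd (hq h1) (Set.disjoint_left.1 h'.disj hva')
  · obtain ⟨v, hva, hva'⟩ := Set.not_subset.1 hns
    rcases mem_ess_or_of_eq_apply heq hva with h1 | h1
    · exact absurd (hp h1) hva'
    · exact ⟨v, h1⟩

/-- Splitting the left part further splits the whole function with a smaller left part. -/
theorem assoc {p q : (V → Bool) → Bool} (h : IsSplit op f a b) (h' : IsSplit op a p q) :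
    IsSplit op f p (fun x => op.apply (q x) (b x)) := by
  have hpa := h'.left_subset
  have hqa := h'.symm.left_subset
  have hqb : IsSplit op (fun x => op.apply (q x) (b x)) q b :=
    ⟨fun _ => rfl, h.disj.mono_left hqa, h'.right, h.right⟩
  refine ⟨fun x => by rw [h.eq, h'.eq, BoolOp.apply_assoc], ?_, h'.left, ?_⟩
  · rw [hqb.ess_eq]
    exact Set.disjoint_union_right.2 ⟨h'.disj, h.disj.mono_left hpa⟩
  · rw [hqb.ess_eq]
    exact h'.right.inl

end IsSplit

end Split

/-! ### Labels built from one operation -/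

namespace BoolOp

/-- The operation conjugated by negation. -/
def dual : BoolOp → BoolOp
  | conj => disj
  | disj => conj
  | parity => parity

/-- Whether the arguments of `labelFn op s` enter negated. -/
def sgn : BoolOp → Bool → Bool
  | conj, s => s
  | disj, s => s
  | parity, _ => false

/-- The initial value of the iteration that defines `labelFn op s`. -/
def init : BoolOp → Bool → Bool
  | conj, _ => true
  | disj, _ => false
  | parity, s => s

end BoolOp

/-- The labels `(¬)AND`, `(¬)OR` and `(¬)XOR`, sorted by the operation `op` that the vertex performs
on its children or on their negations: `AND` and `¬OR` for `conj`, `OR` and `¬AND` for `disj`,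
`XOR` and `¬XOR` for `parity`. In each pair the second label belongs to `s = true`. -/
def labelFn (op : BoolOp) (s : Bool) (k : ℕ) (y : Fin k → Bool) : Bool :=
  Finset.univ.fold op.apply (op.init s) (fun i => xor (y i) (op.sgn s))

theorem fold_conj_eq {ι : Type} (S : Finset ι) (y : ι → Bool) :
    S.fold BoolOp.conj.apply true y = decide (∀ i ∈ S, y i = true) := by
  classical
  induction S using Finset.induction_on with
  | empty => simp
  | insert a S ha ih =>
    rw [Finset.fold_insert ha, ih]
    simp [BoolOp.apply]

theorem fold_disj_eq {ι : Type} (S : Finset ι) (y : ι → Bool) :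
    S.fold BoolOp.disj.apply false y = decide (∃ i ∈ S, y i = true) := by
  classical
  induction S using Finset.induction_on with
  | empty => simp
  | insert a S ha ih =>
    rw [Finset.fold_insert ha, ih]
    simp [BoolOp.apply]

theorem fold_parity_eq {ι : Type} (S : Finset ι) (s : Bool) (y : ι → Bool) :
    S.fold BoolOp.parity.apply s y
      = xor s (decide (Odd (S.filter (fun i => y i = true)).card)) := by
  classical
  induction S using Finset.induction_on with
  | empty => simp
  | insert a S ha ih =>
    rw [Finset.fold_insert ha, ih, Finset.filter_insert]
    cases h : y a
    · simp [BoolOp.apply]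
    · rw [if_pos rfl, Finset.card_insert_of_notMem (by simp [ha])]
      simp only [Nat.odd_add_one, BoolOp.apply, decide_not]
      cases s <;> simp

theorem labelFn_conj_false (k : ℕ) : labelFn .conj false k = andFn k := by
  funext y
  simp [labelFn, fold_conj_eq, BoolOp.init, BoolOp.sgn, andFn]

theorem labelFn_disj_false (k : ℕ) : labelFn .disj false k = orFn k := by
  funext y
  simp [labelFn, fold_disj_eq, BoolOp.init, BoolOp.sgn, orFn]

theorem labelFn_conj_true (k : ℕ) : labelFn .conj true k = notFn (orFn k) := by
  funext y
  simp [labelFn, fold_conj_eq, BoolOp.init, BoolOp.sgn, orFn, notFn, ← decide_not]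

theorem labelFn_disj_true (k : ℕ) : labelFn .disj true k = notFn (andFn k) := by
  funext y
  simp [labelFn, fold_disj_eq, BoolOp.init, BoolOp.sgn, andFn, notFn, ← decide_not]

theorem labelFn_parity_false (k : ℕ) : labelFn .parity false k = xorFn k := by
  funext y
  simp [labelFn, fold_parity_eq, BoolOp.init, BoolOp.sgn, xorFn]

theorem labelFn_parity_true (k : ℕ) : labelFn .parity true k = notFn (xorFn k) := by
  funext y
  simp [labelFn, fold_parity_eq, BoolOp.init, BoolOp.sgn, xorFn, notFn]

theorem notFn_notFn {k : ℕ} (g : (Fin k → Bool) → Bool) : notFn (notFn g) = g := by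
  funext y; simp [notFn]

theorem notFn_labelFn (op : BoolOp) (s : Bool) (k : ℕ) :
    notFn (labelFn op s k) = labelFn op.dual (!s) k := by
  cases op <;> cases s <;>
    simp [BoolOp.dual, labelFn_conj_false, labelFn_conj_true, labelFn_disj_false,
      labelFn_disj_true, labelFn_parity_false, labelFn_parity_true, notFn_notFn]

theorem isAndLabel_iff {k : ℕ} {g : (Fin k → Bool) → Bool} :
    IsAndLabel g ↔ g = labelFn .conj false k ∨ g = labelFn .disj true k := by
  rw [labelFn_conj_false, labelFn_disj_true, IsAndLabel]

theorem isOrLabel_iff {k : ℕ} {g : (Fin k → Bool) → Bool} :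
    IsOrLabel g ↔ g = labelFn .disj false k ∨ g = labelFn .conj true k := by
  rw [labelFn_disj_false, labelFn_conj_true, IsOrLabel]

theorem isXorLabel_iff {k : ℕ} {g : (Fin k → Bool) → Bool} :
    IsXorLabel g ↔ g = labelFn .parity false k ∨ g = labelFn .parity true k := by
  rw [labelFn_parity_false, labelFn_parity_true, IsXorLabel]

theorem isLabel_iff {k : ℕ} {g : (Fin k → Bool) → Bool} :
    IsAndLabel g ∨ IsOrLabel g ∨ IsXorLabel g ↔ ∃ op s, g = labelFn op s k := by
  rw [isAndLabel_iff, isOrLabel_iff, isXorLabel_iff]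
  constructor
  · rintro ((h | h) | (h | h) | (h | h)) <;> exact ⟨_, _, h⟩
  · rintro ⟨op, s, h⟩
    cases op <;> cases s <;> tauto

theorem labelFn_cons (op : BoolOp) (s : Bool) (k : ℕ) (b : Bool) (y : Fin k → Bool) :
    labelFn op s (k + 1) (Fin.cons b y : Fin (k + 1) → Bool)
      = op.apply (xor b (op.sgn s)) (labelFn op s k y) := by
  rw [labelFn, Fin.univ_succ, Finset.fold_cons, Finset.fold_map]
  simp [labelFn]

/-- The argument `i` of `g`, negated if `s = true`, can be split off under `op`. -/
def SplitsAtArg (op : BoolOp) {k : ℕ} (g : (Fin k → Bool) → Bool) (i : Fin k) (s : Bool) : Prop :=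
  ∃ r : (Fin k → Bool) → Bool, i ∉ ess r ∧ ∀ y, g y = op.apply (xor (y i) s) (r y)

theorem splitsAtArg_labelFn (op : BoolOp) (s : Bool) {k : ℕ} (i : Fin k) :
    SplitsAtArg op (labelFn op s k) i (op.sgn s) := by
  refine ⟨fun y => (Finset.univ.erase i).fold op.apply (op.init s) fun j => xor (y j) (op.sgn s),
    ?_, fun y => ?_⟩
  · have : DependsOn (fun y : Fin k → Bool =>
        (Finset.univ.erase i).fold op.apply (op.init s) fun j => xor (y j) (op.sgn s)) {i}ᶜ := by
      intro x y hxy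
      refine Finset.fold_congr fun j hj => ?_
      rw [hxy j (by simpa using hj)]
    intro hi
    exact ess_subset_of_dependsOn this hi rfl
  · rw [labelFn, ← Finset.insert_erase (Finset.mem_univ i), Finset.fold_insert (by simp)]
    simp

/-- A nonconstant function that is constant on all but one input is a conjunction or a disjunction
of literals, so every argument can be split off. -/
theorem ConstantButOne.exists_splitsAtArg {k : ℕ} {g : (Fin k → Bool) → Bool}
    (h : ConstantButOne g) (hg : ∃ y y', g y ≠ g y') (i : Fin k) :
    ∃ op s, SplitsAtArg op g i s := by
  obtain ⟨y₀, b, hb⟩ := h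
  have h0 : g y₀ = !b := by
    obtain ⟨y, y', hne⟩ := hg
    by_cases h1 : y = y₀
    · by_cases h2 : y' = y₀
      · exact absurd (by rw [h1, h2]) hne
      · subst h1
        rw [hb y' h2] at hne
        revert hne
        cases g y <;> cases b <;> simp
    · by_cases h2 : y' = y₀
      · subst h2
        rw [hb y h1] at hne
        revert hne
        cases g y' <;> cases b <;> simp
      · exact absurd (by rw [hb y h1, hb y' h2]) hne
  have hess : ∀ r : (Fin k → Bool) → Bool, DependsOn r {i}ᶜ → i ∉ ess r := fun r hr hi =>
    ess_subset_of_dependsOn hr hi rfl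
  have hdep : DependsOn (fun y : Fin k → Bool => decide (∀ j, j ≠ i → y j = y₀ j)) {i}ᶜ := by
    intro x y hxy
    have : (∀ j, j ≠ i → x j = y₀ j) ↔ ∀ j, j ≠ i → y j = y₀ j :=
      forall_congr' fun j => imp_congr_right fun hj => by rw [hxy j hj]
    simp only [this]
  have heq : ∀ y : Fin k → Bool, y = y₀ ↔ (y i = y₀ i ∧ ∀ j, j ≠ i → y j = y₀ j) := by
    intro y
    constructor
    · rintro rfl; simp
    · rintro ⟨h1, h2⟩
      funext j
      by_cases hj : j = i
      · rw [hj, h1]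
      · exact h2 j hj
  cases b
  · refine ⟨.conj, !(y₀ i), _, hess _ hdep, fun y => ?_⟩
    by_cases hy : y = y₀
    · subst hy
      simp [h0, BoolOp.apply]
    · rw [hb y hy]
      rw [heq, not_and] at hy
      by_cases h1 : y i = y₀ i
      · simp [BoolOp.apply, -not_forall, hy h1]
      · simp [BoolOp.apply, h1]
  · have hdep' : DependsOn (fun y : Fin k → Bool => !decide (∀ j, j ≠ i → y j = y₀ j)) {i}ᶜ :=
      fun x y hxy => congrArg not (hdep hxy)
    refine ⟨.disj, y₀ i, _, hess _ hdep', fun y => ?_⟩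
    by_cases hy : y = y₀
    · subst hy
      simp [h0, BoolOp.apply]
    · rw [hb y hy]
      rw [heq, not_and] at hy
      by_cases h1 : y i = y₀ i
      · simp [BoolOp.apply, -not_forall, hy h1]
      · simp [BoolOp.apply, h1]

/-- With at least two arguments, parity takes both values outside any given point. -/
theorem not_constantButOne_labelFn_parity {k : ℕ} (hk : 2 ≤ k) (s : Bool) :
    ¬ ConstantButOne (labelFn .parity s k) := by
  rintro ⟨y₀, b, hb⟩
  set i : Fin k := ⟨0, by lia⟩
  set j : Fin k := ⟨1, by lia⟩
  have hij : j ≠ i := by simp [i, j, Fin.ext_iff]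
  obtain ⟨r, hr, hg⟩ := splitsAtArg_labelFn .parity s i
  set y₁ := Function.update y₀ j (!(y₀ j))
  have hj : ∀ p, Function.update y₁ i p ≠ y₀ := by
    intro p h
    have := congrFun h j
    simp [y₁, hij] at this
  have h1 := hb _ (hj true)
  have h2 := hb _ (hj false)
  rw [hg, update_of_notMem_ess hr] at h1 h2
  rw [← h2] at h1
  revert h1
  simp only [Function.update_self, BoolOp.apply, BoolOp.sgn]
  cases r y₁ <;> simp

/-- A function that depends on both of its two arguments is a conjunction or a disjunction of
literals or a parity. -/
theorem two_args {g : (Fin 2 → Bool) → Bool} (hg : ∀ i, DependsOnArg g i) :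
    ConstantButOne g ∨ IsXorLabel g := by
  have hv : ∀ y : Fin 2 → Bool, y = ![y 0, y 1] := by
    intro y; funext i; fin_cases i <;> rfl
  have key : ∀ f : Bool → Bool → Bool,
      (∃ b, f true b ≠ f false b) → (∃ a, f a true ≠ f a false) →
      (∃ a₀ b₀ c, ∀ a b, (a ≠ a₀ ∨ b ≠ b₀) → f a b = c) ∨
        (∃ s, ∀ a b, f a b = xor s (xor a b)) := by
    intro f
    simp only [Bool.exists_bool, Bool.forall_bool]
    generalize f true true = p
    generalize f true false = q
    generalize f false true = r
    generalize f false false = t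
    cases p <;> cases q <;> cases r <;> cases t <;> simp
  have hf : ∀ y, g y = (fun a b => g ![a, b]) (y 0) (y 1) := fun y => congrArg g (hv y)
  have h0 : ∃ b, g ![true, b] ≠ g ![false, b] := by
    obtain ⟨y, hy⟩ := hg 0
    refine ⟨y 1, ?_⟩
    rw [hf, hf (Function.update y 0 false)] at hy
    simpa using hy
  have h1 : ∃ a, g ![a, true] ≠ g ![a, false] := by
    obtain ⟨y, hy⟩ := hg 1
    refine ⟨y 0, ?_⟩
    rw [hf, hf (Function.update y 1 false)] at hy
    simpa using hy
  rcases key (fun a b => g ![a, b]) h0 h1 with ⟨a₀, b₀, c, h⟩ | ⟨s, h⟩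
  · refine Or.inl ⟨![a₀, b₀], c, fun y hy => ?_⟩
    rw [hf]
    refine h _ _ ?_
    by_contra! hab
    exact hy (by rw [hv y, hab.1, hab.2])
  · refine Or.inr (isXorLabel_iff.2 ?_)
    have : g = labelFn .parity s 2 := by
      funext y
      rw [hf]
      dsimp only
      rw [h]
      simp only [labelFn, Fin.univ_succ, Finset.fold_cons, Finset.fold_map]
      simp only [BoolOp.apply, BoolOp.init, BoolOp.sgn]
      simp [Function.comp_def]
      cases s <;> cases y 0 <;> cases y 1 <;> rfl
    cases s <;> tauto

/-! ### Compositions over disjoint sets of variables -/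

section Composition

variable {V : Type} [DecidableEq V]

/-- `f` arises from `g` by substituting nonconstant functions without common variables for its
arguments, of which there are at least two, all of them essential. -/
structure IsComp {k : ℕ} (f : (V → Bool) → Bool) (g : (Fin k → Bool) → Bool)
    (c : Fin k → (V → Bool) → Bool) : Prop where
  eq : ∀ x, f x = g (fun i => c i x)
  two_le : 2 ≤ k
  args : ∀ i, DependsOnArg g i
  disj : ∀ i j, i ≠ j → Disjoint (ess (c i)) (ess (c j))
  nonempty : ∀ i, (ess (c i)).Nonempty

/-- Independent nonconstant functions take all combinations of values. -/
theorem exists_forall_eq [Finite V] {k : ℕ} {c : Fin k → (V → Bool) → Bool}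
    (hd : ∀ i j, i ≠ j → Disjoint (ess (c i)) (ess (c j))) (hn : ∀ i, (ess (c i)).Nonempty)
    (y : Fin k → Bool) : ∃ x, ∀ i, c i x = y i := by
  choose xs hxs using fun i => exists_eq_of_ess_nonempty (hn i) (y i)
  obtain ⟨x, hx⟩ := exists_glue (fun i => ess (c i)) hd xs
  exact ⟨x, fun i => by rw [← hxs i]; exact dependsOn_ess (c i) fun v hv => hx i v hv⟩

theorem ess_comp_subset {k : ℕ} {f : (V → Bool) → Bool} {g : (Fin k → Bool) → Bool}
    {c : Fin k → (V → Bool) → Bool} (h : ∀ x, f x = g (fun i => c i x)) :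
    ess f ⊆ ⋃ i, ess (c i) := by
  rintro v ⟨x, hx⟩
  by_contra hv
  simp only [Set.mem_iUnion, not_exists] at hv
  exact hx (by simp only [h, fun i => update_of_notMem_ess (hv i)])

theorem comp_update {k : ℕ} (r : (Fin k → Bool) → Bool) {c : Fin k → (V → Bool) → Bool} {i : Fin k}
    {v : V} (hv : ∀ j, j ≠ i → v ∉ ess (c j)) (x : V → Bool) (b : Bool) :
    r (fun j => c j (Function.update x v b))
      = r (Function.update (fun j => c j x) i (c i (Function.update x v b))) := by
  congr 1
  funext j
  by_cases hj : j = i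
  · subst hj; simp
  · simp [hj, update_of_notMem_ess (hv j hj)]

theorem dependsOnArg_of_mem_ess {k : ℕ} {f : (V → Bool) → Bool} {g : (Fin k → Bool) → Bool}
    {c : Fin k → (V → Bool) → Bool} (h : ∀ x, f x = g (fun i => c i x)) {v : V} (hv : v ∈ ess f)
    {i : Fin k} (hi : ∀ j, j ≠ i → v ∉ ess (c j)) : DependsOnArg g i := by
  by_contra hg
  obtain ⟨x, hx⟩ := hv
  refine hx ?_
  rw [h, h, comp_update g hi, comp_update g hi, update_of_notMem_ess hg, update_of_notMem_ess hg]

namespace IsComp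

variable {k : ℕ} {f : (V → Bool) → Bool} {g : (Fin k → Bool) → Bool} {c : Fin k → (V → Bool) → Bool}

theorem notMem (h : IsComp f g c) {i : Fin k} {v : V} (hv : v ∈ ess (c i)) :
    ∀ j, j ≠ i → v ∉ ess (c j) :=
  fun j hj => Set.disjoint_left.1 (h.disj i j hj.symm) hv

theorem exists_ne (h : IsComp f g c) (i : Fin k) : ∃ j, j ≠ i :=
  have : Nontrivial (Fin k) := Fin.nontrivial_iff_two_le.2 h.two_le
  _root_.exists_ne i

theorem subset_ess [Finite V] (h : IsComp f g c) (i : Fin k) : ess (c i) ⊆ ess f := by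
  rintro v hv
  have hv' := h.notMem hv
  obtain ⟨x, hx⟩ := hv
  obtain ⟨y, hy⟩ := h.args i
  choose xs hxs using fun j => exists_eq_of_ess_nonempty (h.nonempty j) (y j)
  obtain ⟨z, hz⟩ := exists_glue (fun i => ess (c i)) h.disj (Function.update xs i x)
  have h1 : ∀ j, j ≠ i → c j z = y j := by
    intro j hj
    rw [← hxs j]
    exact dependsOn_ess (c j) fun v hv => by rw [hz j v hv, Function.update_of_ne hj]
  have h2 : ∀ b, c i (Function.update z v b) = c i (Function.update x v b) := by
    intro b
    refine dependsOn_ess (c i) fun w hw => ?_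
    by_cases hwv : w = v
    · subst hwv; simp
    · rw [Function.update_of_ne hwv, Function.update_of_ne hwv, hz i w hw, Function.update_self]
  have h3 : ∀ b, f (Function.update z v b)
      = g (Function.update y i (c i (Function.update x v b))) := by
    intro b
    rw [h.eq, comp_update g hv', h2]
    congr 1
    funext j
    by_cases hj : j = i
    · subst hj; simp
    · simp [hj, h1]
  refine ⟨z, ?_⟩
  rw [h3, h3]
  revert hx
  cases c i (Function.update x v true) <;> cases c i (Function.update x v false) <;>
    simp [hy, hy.symm]

theorem ess_eq [Finite V] (h : IsComp f g c) : ess f = ⋃ i, ess (c i) :=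
  Set.Subset.antisymm (ess_comp_subset h.eq) (Set.iUnion_subset h.subset_ess)

theorem not_ess_subset [Finite V] (h : IsComp f g c) (i : Fin k) : ¬ ess f ⊆ ess (c i) := by
  intro hs
  obtain ⟨j, hj⟩ := h.exists_ne i
  obtain ⟨v, hv⟩ := h.nonempty j
  exact h.notMem hv i hj.symm (hs (h.subset_ess j hv))

/-- If an argument can be split off from the outer function, then the function substituted for it
splits off from the composition. -/
theorem isSplit [Finite V] (h : IsComp f g c) {op : BoolOp} {i : Fin k} {s : Bool}
    (hg : SplitsAtArg op g i s) : ∃ b, IsSplit op f (fun x => xor (c i x) s) b := by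
  obtain ⟨r, hr, hgr⟩ := hg
  have heq : ∀ x, f x = op.apply (xor (c i x) s) (r fun j => c j x) := fun x => by rw [h.eq, hgr]
  refine ⟨fun x => r (fun j => c j x), heq, ?_, ?_, ?_⟩
  · rw [ess_xor, Set.disjoint_left]
    rintro v hv ⟨x, hx⟩
    refine hx ?_
    simp only [comp_update r (h.notMem hv), update_of_notMem_ess hr]
  · rw [ess_xor]; exact h.nonempty i
  · obtain ⟨j, hj⟩ := h.exists_ne i
    obtain ⟨v, hv⟩ := h.nonempty j
    rcases mem_ess_or_of_eq_apply heq (h.subset_ess j hv) with h1 | h1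
    · rw [ess_xor] at h1
      exact absurd h1 (h.notMem hv i hj.symm)
    · exact ⟨v, h1⟩

end IsComp

end Composition

/-! ### Distinct variable trees -/

namespace BoolTree

/-- The Boolean function represented by a tree. -/
abbrev fn {V : Type} (T : BoolTree V) (x : V → Bool) : Bool := T.eval x

theorem negRoot_negRoot {V : Type} (T : BoolTree V) : T.negRoot.negRoot = T := by
  cases T <;> simp [negRoot, notFn_notFn]

theorem eval_negRoot {V : Type} (T : BoolTree V) (x : V → Bool) :
    T.negRoot.eval x = !(T.eval x) := by
  cases T <;> simp [negRoot, eval, notFn]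

theorem numInner_negRoot {V : Type} (T : BoolTree V) : T.negRoot.numInner = T.numInner := by
  cases T <;> simp [negRoot, numInner]

theorem dependsOnArg_notFn {k : ℕ} {g : (Fin k → Bool) → Bool} {i : Fin k}
    (h : DependsOnArg g i) : DependsOnArg (notFn g) i := by
  obtain ⟨y, hy⟩ := h
  exact ⟨y, by simpa [notFn] using hy⟩

theorem IsDistinctVariable.negRoot {V : Type} {T : BoolTree V} (h : T.IsDistinctVariable) :
    T.negRoot.IsDistinctVariable := by
  cases T with
  | leaf v s => exact h
  | node k g c => exact ⟨h.1, fun i => dependsOnArg_notFn (h.2.1 i), h.2.2⟩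

/-- The tree itself if `s = false`, and its negation if `s = true`. -/
def negIf {V : Type} (s : Bool) (T : BoolTree V) : BoolTree V := if s then T.negRoot else T

theorem negIf_false {V : Type} (T : BoolTree V) : negIf false T = T := rfl

theorem negIf_true {V : Type} (T : BoolTree V) : negIf true T = T.negRoot := rfl

theorem eval_negIf {V : Type} (s : Bool) (T : BoolTree V) (x : V → Bool) :
    (negIf s T).eval x = xor (T.eval x) s := by
  cases s <;> simp [negIf, eval_negRoot]

theorem vars_nonempty {V : Type} {T : BoolTree V} (h : T.IsDistinctVariable) : T.vars.Nonempty := by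
  induction T with
  | leaf v s => exact ⟨v, rfl⟩
  | node k g c ih =>
    obtain ⟨v, hv⟩ := ih ⟨0, by have := h.1; lia⟩ (h.2.2.2 _)
    exact ⟨v, Set.mem_iUnion.2 ⟨_, hv⟩⟩

theorem dependsOn_vars {V : Type} (T : BoolTree V) : DependsOn T.fn T.vars := by
  induction T with
  | leaf v s => intro x y h; simp [fn, eval, h v rfl]
  | node k g c ih =>
    intro x y h
    simp only [fn, eval]
    congr 1
    funext i
    exact ih i fun v hv => h v (Set.mem_iUnion.2 ⟨i, hv⟩)

variable {V : Type} [DecidableEq V]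

theorem ess_leaf (v : V) (s : Bool) : ess (leaf v s).fn = {v} := ess_literal v s

/-- A node is the root of a distinct variable tree as soon as the represented function depends on
some variable below each child. -/
theorem isDistinctVariable_node {k : ℕ} {g : (Fin k → Bool) → Bool} {c : Fin k → BoolTree V}
    (hk : 2 ≤ k) (hd : ∀ i j, i ≠ j → Disjoint (c i).vars (c j).vars)
    (hc : ∀ i, (c i).IsDistinctVariable)
    (he : ∀ i, ∃ v ∈ (c i).vars, v ∈ ess (node k g c).fn) :
    (node k g c).IsDistinctVariable := by
  refine ⟨hk, fun i => ?_, hd, hc⟩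
  obtain ⟨v, hv, hv'⟩ := he i
  refine dependsOnArg_of_mem_ess (c := fun i => (c i).fn) (fun x => rfl) hv' fun j hj hvj => ?_
  exact Set.disjoint_left.1 (hd i j hj.symm) hv
    (ess_subset_of_dependsOn (dependsOn_vars (c j)) hvj)

variable [Finite V]

theorem ess_fn {T : BoolTree V} (h : T.IsDistinctVariable) : ess T.fn = T.vars := by
  induction T with
  | leaf v s => exact ess_leaf v s
  | node k g c ih =>
    have ih' := fun i => ih i (h.2.2.2 i)
    have : IsComp (node k g c).fn g (fun i => (c i).fn) :=
      ⟨fun x => rfl, h.1, h.2.1, fun i j hij => by rw [ih', ih']; exact h.2.2.1 i j hij,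
        fun i => by rw [ih']; exact vars_nonempty (h.2.2.2 i)⟩
    rw [this.ess_eq]
    simp only [ih', vars]

theorem isComp_node {k : ℕ} {g : (Fin k → Bool) → Bool} {c : Fin k → BoolTree V}
    (h : (node k g c).IsDistinctVariable) :
    IsComp (node k g c).fn g (fun i => (c i).fn) :=
  ⟨fun x => rfl, h.1, h.2.1,
    fun i j hij => by rw [ess_fn (h.2.2.2 i), ess_fn (h.2.2.2 j)]; exact h.2.2.1 i j hij,
    fun i => by rw [ess_fn (h.2.2.2 i)]; exact vars_nonempty (h.2.2.2 i)⟩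

end BoolTree

/-! ### Bound sets of variables -/

/-- The variables in `A` enter `f` through one bit only, namely the value of `h`. -/
def IsBound {V : Type} (f : (V → Bool) → Bool) (A : Set V) : Prop :=
  ∃ h f₁ f₀ : (V → Bool) → Bool, DependsOn h A ∧ DependsOn f₁ Aᶜ ∧ DependsOn f₀ Aᶜ ∧
    ∀ x, f x = if h x then f₁ x else f₀ x

open BoolTree in
/-- A bound set that is neither a singleton nor everything yields a tree with two inner vertices:
the lower one collects the arguments in the set. -/
theorem hasNontrivialTree_of_isBound {k : ℕ} {g : (Fin k → Bool) → Bool}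
    (hg : ∀ i, DependsOnArg g i) (J : Finset (Fin k)) (h2 : 2 ≤ J.card) (hJ : J ≠ Finset.univ)
    (hb : IsBound g (J : Set (Fin k))) : HasNontrivialTree g := by
  obtain ⟨H, G₁, G₀, hH, hG₁, hG₀, heq⟩ := hb
  set K : Finset (Fin k) := Jᶜ with hK
  have hKpos : 0 < K.card := by
    rw [Finset.card_pos, Finset.nonempty_iff_ne_empty]
    simpa [hK] using hJ
  have hKJ : (K : Set (Fin k)) = (J : Set (Fin k))ᶜ := by simp [hK]
  set eJ := J.equivFin
  set eK := K.equivFin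
  set extJ : (Fin J.card → Bool) → Fin k → Bool := fun z p =>
    if hp : p ∈ J then z (eJ ⟨p, hp⟩) else false with hextJ
  set extK : (Fin K.card → Bool) → Fin k → Bool := fun z p =>
    if hp : p ∈ K then z (eK ⟨p, hp⟩) else false with hextK
  set lower : BoolTree (Fin k) :=
    node J.card (fun z => H (extJ z)) (fun i => leaf (eJ.symm i : Fin k) false) with hlower
  have hlow : ∀ y, lower.eval y = H y := by
    intro y
    simp only [hlower, eval, Bool.false_bne]
    refine hH fun p hp => ?_
    have hp' : p ∈ J := hp
    simp [hextJ, hp']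
  have hlowfn : lower.fn = H := funext hlow
  set ch : Fin (K.card + 1) → BoolTree (Fin k) :=
    Fin.cons lower (fun i => leaf (eK.symm i : Fin k) false) with hch
  set lab : (Fin (K.card + 1) → Bool) → Bool := fun w =>
    if w 0 then G₁ (extK fun i => w i.succ) else G₀ (extK fun i => w i.succ) with hlab
  have hroot : ∀ y, (node (K.card + 1) lab ch).eval y = g y := by
    intro y
    have hext : ∀ p ∈ (J : Set (Fin k))ᶜ, extK (fun i => y (eK.symm i : Fin k)) p = y p := by
      intro p hp
      have hp' : p ∈ K := by simpa [hK] using hp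
      simp [hextK, hp']
    simp only [eval, hlab, hch, Fin.cons_zero, Fin.cons_succ, hlow, Bool.false_bne]
    rw [heq, hG₁ hext, hG₀ hext]
  have hrootfn : (node (K.card + 1) lab ch).fn = g := funext hroot
  have hvJ : ∀ i, (eJ.symm i : Fin k) ∈ J := fun i => (eJ.symm i).2
  have hvK : ∀ i, (eK.symm i : Fin k) ∉ J := fun i =>
    Finset.mem_compl.1 (eK.symm i).2
  have hessH : ∀ p ∈ J, p ∈ ess H := by
    intro p hp
    have h1 : p ∉ ess G₁ := fun h => ess_subset_of_dependsOn hG₁ h hp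
    have h0 : p ∉ ess G₀ := fun h => ess_subset_of_dependsOn hG₀ h hp
    by_contra hpH
    obtain ⟨y, hy⟩ := hg p
    refine hy ?_
    simp only [heq, update_of_notMem_ess h1, update_of_notMem_ess h0, update_of_notMem_ess hpH]
  have hlowvars : lower.vars = (J : Set (Fin k)) := by
    ext p
    simp only [hlower, vars, Set.mem_iUnion, Set.mem_singleton_iff, Finset.mem_coe]
    constructor
    · rintro ⟨i, rfl⟩; exact hvJ i
    · intro hp; exact ⟨eJ ⟨p, hp⟩, by simp⟩
  have hlowdv : lower.IsDistinctVariable := by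
    refine isDistinctVariable_node h2 (fun i j hij => ?_) (fun i => trivial) fun i => ?_
    · simp only [vars, Set.disjoint_singleton]
      intro h
      exact hij (eJ.symm.injective (Subtype.ext h))
    · refine ⟨_, rfl, ?_⟩
      rw [← hlower, hlowfn]
      exact hessH _ (hvJ i)
  refine ⟨node (K.card + 1) lab ch, ?_, ?_, hroot⟩
  · refine isDistinctVariable_node (by lia) (fun i j hij => ?_) (fun i => ?_) fun i => ?_
    · induction i using Fin.cases with
      | zero =>
        induction j using Fin.cases with
        | zero => exact absurd rfl hij
        | succ j => simpa [hch, hlowvars, vars] using hvK j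
      | succ i =>
        induction j using Fin.cases with
        | zero => simpa [hch, hlowvars, vars] using hvK i
        | succ j =>
          simp only [hch, Fin.cons_succ, vars, Set.disjoint_singleton]
          intro h
          exact hij (congrArg Fin.succ (eK.symm.injective (Subtype.ext h)))
    · induction i using Fin.cases with
      | zero => exact hlowdv
      | succ i => trivial
    · rw [hrootfn]
      obtain ⟨v, hv⟩ : (ch i).vars.Nonempty := by
        apply vars_nonempty
        induction i using Fin.cases with
        | zero => exact hlowdv
        | succ i => trivial
      exact ⟨v, hv, hg v⟩
  · simp only [numInner, Fin.sum_univ_succ, hch, Fin.cons_zero, hlower]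
    lia

section Bound

variable {V : Type} [DecidableEq V] [Finite V]

theorem IsSplit.isBound {op : BoolOp} {f a b : (V → Bool) → Bool} (h : IsSplit op f a b) :
    IsBound f (ess a) := by
  have hb : ∀ p, DependsOn (fun x => op.apply p (b x)) (ess a)ᶜ := fun p x y hxy =>
    congrArg (op.apply p)
      (dependsOn_ess b fun v hv => hxy v (Set.disjoint_right.1 h.disj hv))
  refine ⟨a, _, _, dependsOn_ess a, hb true, hb false, fun x => ?_⟩
  rw [h.eq]
  cases a x <;> simp

namespace IsComp

variable {k : ℕ} {f : (V → Bool) → Bool} {g : (Fin k → Bool) → Bool} {c : Fin k → (V → Bool) → Bool}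

theorem isBound (h : IsComp f g c) (i : Fin k) : IsBound f (ess (c i)) := by
  have hb : ∀ p, DependsOn (fun x => g (Function.update (fun j => c j x) i p)) (ess (c i))ᶜ := by
    intro p x y hxy
    dsimp only
    congr 1
    funext j
    by_cases hj : j = i
    · subst hj; simp
    · simp only [Function.update_of_ne hj]
      exact dependsOn_ess (c j) fun v hv => hxy v (Set.disjoint_left.1 (h.disj j i hj) hv)
  refine ⟨c i, _, _, dependsOn_ess (c i), hb true, hb false, fun x => ?_⟩
  rw [h.eq]
  cases hx : c i x <;> simp [← hx]

/-- If a bound set meets two blocks of a composition and does not contain a third one, restricting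
every block to one suitable variable transports the bound set to the outer function. -/
theorem hasNontrivialTree_of_isBound (h : IsComp f g c) {A : Set V} (hA : IsBound f A)
    {p q m : Fin k} (hpq : p ≠ q) (hpm : p ≠ m) (hqm : q ≠ m) {u u' w : V} (hu : u ∈ ess (c p))
    (huA : u ∈ A) (hu' : u' ∈ ess (c q)) (huA' : u' ∈ A) (hw : w ∈ ess (c m)) (hwA : w ∉ A) :
    HasNontrivialTree g := by
  classical
  obtain ⟨r, hr, hrp, hrq, hrm⟩ : ∃ r : Fin k → V, (∀ i, r i ∈ ess (c i)) ∧ r p = u ∧ r q = u' ∧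
      r m = w := by
    choose r hr using h.nonempty
    refine ⟨Function.update (Function.update (Function.update r p u) q u') m w, fun i => ?_, ?_, ?_,
      ?_⟩
    · by_cases him : i = m
      · subst him; simpa using hw
      by_cases hiq : i = q
      · subst hiq; simpa [hqm] using hu'
      by_cases hip : i = p
      · subst hip; simpa [hpm, hpq] using hu
      simpa [him, hiq, hip] using hr i
    · simp [hpq, hpm]
    · simp [hqm]
    · simp
  have hrinj : ∀ i j, r i ∈ ess (c j) → i = j := fun i j hij => by
    by_contra hne
    exact h.notMem (hr i) j (Ne.symm hne) hij
  -- Along its representative `r i`, each block function becomes a literal.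
  have hlit : ∀ i, ∃ (x : V → Bool) (s : Bool), ∀ b,
      c i (Function.update x (r i) (xor b s)) = b := by
    intro i
    obtain ⟨x, hx⟩ := hr i
    refine ⟨x, !(c i (Function.update x (r i) true)), fun b => ?_⟩
    revert hx
    cases h1 : c i (Function.update x (r i) true) <;>
      cases h2 : c i (Function.update x (r i) false) <;> cases b <;> simp [h1, h2]
  choose xs s hs using hlit
  obtain ⟨e, he⟩ := exists_glue (fun i => ess (c i)) h.disj xs
  set ρ : (Fin k → Bool) → V → Bool := fun y v =>
    if hv : ∃ i, r i = v then xor (y hv.choose) (s hv.choose) else e v with hρ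
  have hρr : ∀ y i, ρ y (r i) = xor (y i) (s i) := by
    intro y i
    have hv : ∃ j, r j = r i := ⟨i, rfl⟩
    have h1 : hv.choose = i := hrinj _ _ (by rw [hv.choose_spec]; exact hr i)
    simp only [hρ, dif_pos hv, h1]
  have hρe : ∀ y v, (¬ ∃ i, r i = v) → ρ y v = e v := fun y v hv => by simp only [hρ, dif_neg hv]
  have hcρ : ∀ y i, c i (ρ y) = y i := by
    intro y i
    rw [← hs i (y i)]
    refine dependsOn_ess (c i) fun v hv => ?_
    by_cases hvi : v = r i
    · subst hvi; simp [hρr]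
    · rw [Function.update_of_ne hvi, hρe, he i v hv]
      rintro ⟨j, rfl⟩
      exact hvi (by rw [hrinj j i hv])
  have hfρ : ∀ y, f (ρ y) = g y := fun y => by simp only [h.eq, hcρ]
  set J : Finset (Fin k) := Finset.univ.filter fun i => r i ∈ A with hJ
  have hdep : ∀ (F : (V → Bool) → Bool) (B : Set V), DependsOn F B →
      DependsOn (fun y => F (ρ y)) {i | r i ∈ B} := by
    intro F B hF y y' hyy
    refine hF fun v hv => ?_
    by_cases hvr : ∃ i, r i = v
    · obtain ⟨i, rfl⟩ := hvr
      rw [hρr, hρr, hyy i hv]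
    · rw [hρe _ _ hvr, hρe _ _ hvr]
  have hpJ : p ∈ J := by simp [hJ, hrp, huA]
  have hqJ : q ∈ J := by simp [hJ, hrq, huA']
  have hmJ : m ∉ J := by simp [hJ, hrm, hwA]
  refine _root_.hasNontrivialTree_of_isBound h.args J
    (Finset.one_lt_card.2 ⟨p, hpJ, q, hqJ, hpq⟩) (fun h => hmJ (h ▸ Finset.mem_univ m)) ?_
  obtain ⟨H, f₁, f₀, hH, hf₁, hf₀, heq⟩ := hA
  have hJA : (J : Set (Fin k)) = {i | r i ∈ A} := by ext i; simp [hJ]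
  have hJA' : (J : Set (Fin k))ᶜ = {i | r i ∈ Aᶜ} := by ext i; simp [hJ]
  refine ⟨_, _, _, hJA ▸ hdep H A hH, hJA' ▸ hdep f₁ Aᶜ hf₁, hJA' ▸ hdep f₀ Aᶜ hf₀, fun y => ?_⟩
  rw [← hfρ, heq]

/-- If the outer function of a composition has at least three arguments and is indecomposable, then
every proper bound set is contained in one block. -/
theorem exists_subset_of_isBound (h : IsComp f g c) (hk : 3 ≤ k) (hg : ¬ HasNontrivialTree g)
    {A : Set V} (hA : IsBound f A) (hAf : ¬ ess f ⊆ A) : ∃ j, A ∩ ess f ⊆ ess (c j) := by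
  by_contra! hcon
  have hmem : ∀ v ∈ ess f, ∃ i, v ∈ ess (c i) := fun v hv => by
    rw [h.ess_eq] at hv; exact Set.mem_iUnion.1 hv
  obtain ⟨u, ⟨huA, huf⟩, -⟩ := Set.not_subset.1 (hcon ⟨0, by lia⟩)
  obtain ⟨p, hp⟩ := hmem u huf
  obtain ⟨u', ⟨huA', huf'⟩, hu'⟩ := Set.not_subset.1 (hcon p)
  obtain ⟨q, hq⟩ := hmem u' huf'
  obtain ⟨w, hwf, hwA⟩ := Set.not_subset.1 hAf
  obtain ⟨m, hm⟩ := hmem w hwf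
  have hpq : p ≠ q := by rintro rfl; exact hu' hq
  -- It suffices to find variables of three different blocks, two of them in `A`.
  have key := fun {p q m} hpq hpm hqm {u u' w} hu huA hu' huA' hw hwA =>
    hg (h.hasNontrivialTree_of_isBound (p := p) (q := q) (m := m) (u := u) (u' := u') (w := w)
      hA hpq hpm hqm hu huA hu' huA' hw hwA)
  obtain ⟨t, htp, htq⟩ : ∃ t, t ≠ p ∧ t ≠ q := by
    have : ({p, q} : Finset (Fin k)).card < Fintype.card (Fin k) := by
      rw [Fintype.card_fin]
      exact lt_of_le_of_lt Finset.card_le_two (by lia)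
    obtain ⟨t, ht⟩ := Finset.exists_mem_notMem_of_card_lt_card (t := Finset.univ) this
    exact ⟨t, by simpa [not_or] using ht.2⟩
  obtain ⟨z, hz⟩ := h.nonempty t
  by_cases hzA : z ∈ A
  · by_cases hmp : m = p
    · subst hmp
      exact key htq.symm hpq.symm htp hq huA' hz hzA hm hwA
    by_cases hmq : m = q
    · subst hmq
      exact key htp.symm hpq htq hp huA hz hzA hm hwA
    exact key hpq (Ne.symm hmp) (Ne.symm hmq) hp huA hq huA' hm hwA
  · exact key hpq htp.symm htq.symm hp huA hq huA' hz hzA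

end IsComp

end Bound

/-! ### Tree decompositions, vertex by vertex -/

namespace BoolTree

variable {V : Type}

/-- The root is a non-leaf vertex whose label performs the operation `op` on the children or on
their negations. -/
def HasRootOp (op : BoolOp) (T : BoolTree V) : Prop :=
  ∃ (k : ℕ) (s : Bool) (c : Fin k → BoolTree V), T = node k (labelFn op s k) c

theorem hasRootOp_node {op : BoolOp} {k : ℕ} {g : (Fin k → Bool) → Bool} {c : Fin k → BoolTree V} :
    (node k g c).HasRootOp op ↔ ∃ s, g = labelFn op s k := by
  constructor
  · rintro ⟨k', s, c', h⟩
    cases h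
    exact ⟨s, rfl⟩
  · rintro ⟨s, rfl⟩
    exact ⟨k, s, c, rfl⟩

theorem hasRootOp_negRoot {op : BoolOp} {T : BoolTree V} :
    T.negRoot.HasRootOp op ↔ T.HasRootOp op.dual := by
  cases T with
  | leaf v s =>
    constructor <;> rintro ⟨k, s, c, h⟩ <;> cases h
  | node k g c =>
    rw [negRoot, hasRootOp_node, hasRootOp_node]
    constructor
    · rintro ⟨s, h⟩
      exact ⟨!s, by rw [← notFn_labelFn, ← h, notFn_notFn]⟩
    · rintro ⟨s, h⟩
      exact ⟨!s, by rw [h, notFn_labelFn]; cases op <;> rfl⟩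

theorem not_hasRootOp_iff {op : BoolOp} {T : BoolTree V} :
    ¬ T.HasRootOp op ↔ ∀ (l : ℕ) (h : (Fin l → Bool) → Bool) (d : Fin l → BoolTree V),
      T = node l h d → h ≠ labelFn op false l ∧ h ≠ labelFn op true l := by
  constructor
  · rintro hT l h d rfl
    rw [hasRootOp_node, Bool.exists_bool, not_or] at hT
    exact hT
  · rintro hT ⟨k, s, c, rfl⟩
    have := hT k _ c rfl
    cases s
    · exact this.1 rfl
    · exact this.2 rfl

/-- The conditions which a tree decomposition imposes on a non-leaf vertex with label `g` and
children `c`. The three conditions on children of vertices labeled `(¬)AND`, `(¬)OR`, `(¬)XOR` are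
combined into one: if the vertex performs `op` on its children, negated or not, then none of these
negated or unnegated children performs `op` in turn. -/
structure IsGoodNode {k : ℕ} (g : (Fin k → Bool) → Bool) (c : Fin k → BoolTree V) : Prop where
  indecomposable : HasNontrivialTree g → ∃ op s, g = labelFn op s k
  child : ∀ op s, g = labelFn op s k → ∀ i, ¬ ((c i).negIf (op.sgn s)).HasRootOp op
  constantButOne : ConstantButOne g → IsAndLabel g ∨ IsOrLabel g

theorem child_condition_iff {k : ℕ} {g : (Fin k → Bool) → Bool} {c : Fin k → BoolTree V} :
    (∀ op s, g = labelFn op s k → ∀ i, ¬ ((c i).negIf (op.sgn s)).HasRootOp op) ↔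
      (IsAndLabel g → ∀ i, ¬ (c i).HasRootOp .conj) ∧
      (IsOrLabel g → ∀ i, ¬ (c i).HasRootOp .disj) ∧
      (IsXorLabel g → ∀ i, ¬ (c i).HasRootOp .parity) := by
  rw [isAndLabel_iff, isOrLabel_iff, isXorLabel_iff]
  constructor
  · intro h
    refine ⟨?_, ?_, ?_⟩ <;> rintro (hg | hg) i
    · exact h _ _ hg i
    · exact fun hi => h _ _ hg i (hasRootOp_negRoot.2 hi)
    · exact h _ _ hg i
    · exact fun hi => h _ _ hg i (hasRootOp_negRoot.2 hi)
    · exact h _ _ hg i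
    · exact h _ _ hg i
  · rintro ⟨h1, h2, h3⟩ op s hg i
    cases op <;> cases s
    · exact h1 (Or.inl hg) i
    · exact fun hi => h2 (Or.inr hg) i (hasRootOp_negRoot.1 hi)
    · exact h2 (Or.inl hg) i
    · exact fun hi => h1 (Or.inr hg) i (hasRootOp_negRoot.1 hi)
    · exact h3 (Or.inl hg) i
    · exact h3 (Or.inr hg) i

end BoolTree

open BoolTree

section

variable {V : Type}

theorem IsTreeDecomposition.fn_eq {T : BoolTree V} {f : (V → Bool) → Bool}
    (h : IsTreeDecomposition T f) : T.fn = f := funext h.represents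

theorem isTreeDecomposition_leaf (v : V) (s : Bool) :
    IsTreeDecomposition (leaf v s) (leaf v s).fn := by
  constructor
  · trivial
  · exact fun _ => rfl
  all_goals intro k g c h; cases h

theorem isTreeDecomposition_node {k : ℕ} {g : (Fin k → Bool) → Bool} {c : Fin k → BoolTree V}
    {f : (V → Bool) → Bool} (hd : (node k g c).IsDistinctVariable)
    (hf : ∀ x, (node k g c).eval x = f x) (hg : IsGoodNode g c)
    (hc : ∀ i, IsTreeDecomposition (c i) (c i).fn) : IsTreeDecomposition (node k g c) f := by
  obtain ⟨h1, h2, h3⟩ := child_condition_iff.1 hg.child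
  have hi := hg.indecomposable
  rw [← isLabel_iff] at hi
  refine ⟨hd, hf, ?_, ?_, ?_, ?_, ?_⟩ <;> intro k' g' c' hs
  · cases hs with
    | refl => exact hi
    | child _ _ i h => exact (hc i).indecomposable _ _ _ h
  · cases hs with
    | refl =>
      intro ha i l h d hci
      have := not_hasRootOp_iff.1 (h1 ha i) l h d hci
      rwa [labelFn_conj_false, labelFn_conj_true] at this
    | child _ _ i h => exact (hc i).and_child _ _ _ h
  · cases hs with
    | refl =>
      intro ha i l h d hci
      have := not_hasRootOp_iff.1 (h2 ha i) l h d hci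
      rwa [labelFn_disj_false, labelFn_disj_true] at this
    | child _ _ i h => exact (hc i).or_child _ _ _ h
  · cases hs with
    | refl =>
      intro ha i l h d hci
      have := not_hasRootOp_iff.1 (h3 ha i) l h d hci
      rwa [isXorLabel_iff, not_or]
    | child _ _ i h => exact (hc i).xor_child _ _ _ h
  · cases hs with
    | refl => exact hg.constantButOne
    | child _ _ i h => exact (hc i).constantButOne _ _ _ h

namespace IsTreeDecomposition

variable {f : (V → Bool) → Bool} {k : ℕ} {g : (Fin k → Bool) → Bool} {c : Fin k → BoolTree V}

theorem child (h : IsTreeDecomposition (node k g c) f) (i : Fin k) :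
    IsTreeDecomposition (c i) (c i).fn :=
  ⟨h.distinctVariable.2.2.2 i, fun _ => rfl,
    fun _ _ _ hs => h.indecomposable _ _ _ (hs.child _ _ i),
    fun _ _ _ hs => h.and_child _ _ _ (hs.child _ _ i),
    fun _ _ _ hs => h.or_child _ _ _ (hs.child _ _ i),
    fun _ _ _ hs => h.xor_child _ _ _ (hs.child _ _ i),
    fun _ _ _ hs => h.constantButOne _ _ _ (hs.child _ _ i)⟩

theorem isGoodNode (h : IsTreeDecomposition (node k g c) f) : IsGoodNode g c := by
  refine ⟨fun hn => isLabel_iff.1 (h.indecomposable _ _ _ (.refl _) hn),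
    child_condition_iff.2 ⟨fun hg i => not_hasRootOp_iff.2 fun l h' d hd => ?_,
      fun hg i => not_hasRootOp_iff.2 fun l h' d hd => ?_,
      fun hg i => not_hasRootOp_iff.2 fun l h' d hd => ?_⟩, h.constantButOne _ _ _ (.refl _)⟩
  · rw [labelFn_conj_false, labelFn_conj_true]
    exact h.and_child _ _ _ (.refl _) hg i l h' d hd
  · rw [labelFn_disj_false, labelFn_disj_true]
    exact h.or_child _ _ _ (.refl _) hg i l h' d hd
  · have := h.xor_child _ _ _ (.refl _) hg i l h' d hd
    rwa [isXorLabel_iff, not_or] at this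

/-- Negating the root of a tree decomposition gives one of the negated function. -/
theorem negRoot {T : BoolTree V} (h : IsTreeDecomposition T f) :
    IsTreeDecomposition T.negRoot T.negRoot.fn := by
  cases T with
  | leaf v s => exact isTreeDecomposition_leaf v (!s)
  | node k g c =>
    have hg := h.isGoodNode
    refine isTreeDecomposition_node h.distinctVariable.negRoot (fun _ => rfl) ⟨?_, ?_, ?_⟩ h.child
    · rintro ⟨T, hT, hT2, hTe⟩
      obtain ⟨op, s, hs⟩ := hg.indecomposable ⟨T.negRoot, hT.negRoot,
        by rwa [numInner_negRoot], fun y => by rw [eval_negRoot, hTe]; simp [notFn]⟩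
      exact ⟨op.dual, !s, by rw [hs, notFn_labelFn]⟩
    · intro op s hs i hi
      have hs' : g = labelFn op.dual (!s) k := by rw [← notFn_labelFn, ← hs, notFn_notFn]
      refine hg.child _ _ hs' i ?_
      cases op <;> cases s <;>
        simpa [BoolOp.dual, BoolOp.sgn, negIf, hasRootOp_negRoot] using hi
    · rintro ⟨y₀, b, hb⟩
      have := hg.constantButOne ⟨y₀, !b, fun y hy => by rw [← hb y hy]; simp [notFn]⟩
      rw [isAndLabel_iff, isOrLabel_iff] at this ⊢
      rcases this with (h1 | h1) | (h1 | h1) <;> rw [h1, notFn_labelFn] <;> simp [BoolOp.dual]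

theorem negIf {T : BoolTree V} (h : IsTreeDecomposition T f) (s : Bool) :
    IsTreeDecomposition (T.negIf s) (T.negIf s).fn := by
  cases s
  · have := h.fn_eq; subst this; exact h
  · exact h.negRoot

variable [DecidableEq V] [Finite V]

theorem isComp (h : IsTreeDecomposition (node k g c) f) : IsComp f g (fun i => (c i).fn) :=
  h.fn_eq ▸ isComp_node h.distinctVariable

theorem isComp_vars (h : IsTreeDecomposition (node k g c) f) (i : Fin k) :
    ess (c i).fn = (c i).vars := ess_fn (h.child i).distinctVariable

/-- A label that performs no operation of the three kinds has at least three arguments. -/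
theorem three_le (h : IsTreeDecomposition (node k g c) f) (hg : ¬ ∃ op s, g = labelFn op s k) :
    3 ≤ k := by
  by_contra hk
  have h2 := h.isComp.two_le
  obtain rfl : k = 2 := by lia
  rw [← isLabel_iff] at hg
  rcases two_args h.isComp.args with h1 | h1
  · exact hg (by have := h.isGoodNode.constantButOne h1; tauto)
  · exact hg (by tauto)

/-- If `f` splits under `op`, then the root of every tree decomposition of `f` performs `op`. -/
theorem hasRootOp {T : BoolTree V} {op : BoolOp} {a b : (V → Bool) → Bool}
    (h : IsTreeDecomposition T f) (hs : IsSplit op f a b) : T.HasRootOp op := by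
  cases T with
  | leaf v s =>
    exfalso
    have hf : ess f = {v} := by rw [← h.fn_eq, ess_leaf]
    obtain ⟨p, hp⟩ := hs.left
    obtain ⟨q, hq⟩ := hs.right
    have hp' := hs.left_subset hp
    have hq' := hs.symm.left_subset hq
    rw [hf] at hp' hq'
    cases hp'
    cases hq'
    exact Set.disjoint_left.1 hs.disj hp hq
  | node k g c =>
    have hc := h.isComp
    by_cases hg : ∃ op s, g = labelFn op s k
    · obtain ⟨op', s, rfl⟩ := hg
      obtain ⟨b', hb'⟩ := hc.isSplit
        (splitsAtArg_labelFn op' s (⟨0, by have := hc.two_le; lia⟩ : Fin k))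
      rw [hs.op_unique hb']
      exact ⟨k, s, c, rfl⟩
    · -- Both parts would be contained in single blocks, but there are at least three blocks.
      exfalso
      have hk := h.three_le hg
      have hnt : ¬ HasNontrivialTree g := fun hn => hg (h.isGoodNode.indecomposable hn)
      have sub : ∀ {a b}, IsSplit op f a b → ∃ j, ess a ⊆ ess (c j).fn := by
        intro a b hs
        have hnot : ¬ ess f ⊆ ess a := by
          intro hsub
          obtain ⟨v, hv⟩ := hs.right
          exact Set.disjoint_right.1 hs.disj hv (hsub (hs.symm.left_subset hv))
        obtain ⟨j, hj⟩ := hc.exists_subset_of_isBound hk hnt hs.isBound hnot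
        exact ⟨j, fun v hv => hj ⟨hv, hs.left_subset hv⟩⟩
      obtain ⟨p, hp⟩ := sub hs
      obtain ⟨q, hq⟩ := sub hs.symm
      obtain ⟨t, ht⟩ : ∃ t : Fin k, t ∉ ({p, q} : Finset (Fin k)) := by
        have : ({p, q} : Finset (Fin k)).card < Fintype.card (Fin k) := by
          rw [Fintype.card_fin]
          exact lt_of_le_of_lt Finset.card_le_two (by lia)
        obtain ⟨t, ht⟩ := Finset.exists_mem_notMem_of_card_lt_card (t := Finset.univ) this
        exact ⟨t, ht.2⟩
      simp only [Finset.mem_insert, Finset.mem_singleton, not_or] at ht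
      obtain ⟨v, hv⟩ := hc.nonempty t
      have hvf := hc.subset_ess t hv
      rw [hs.ess_eq] at hvf
      rcases hvf with h1 | h1
      · exact hc.notMem hv p (Ne.symm ht.1) (hp h1)
      · exact hc.notMem hv q (Ne.symm ht.2) (hq h1)

/-- In two tree decompositions of the same function, the variables below a child of the first root
all lie below one child of the second root. -/
theorem exists_vars_subset {l : ℕ} {h : (Fin l → Bool) → Bool} {d : Fin l → BoolTree V}
    (hT : IsTreeDecomposition (node k g c) f) (hZ : IsTreeDecomposition (node l h d) f)
    (i : Fin k) : ∃ j, (c i).vars ⊆ (d j).vars := by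
  have hTc := hT.isComp
  have hZc := hZ.isComp
  rw [← hT.isComp_vars]
  simp only [← hZ.isComp_vars]
  by_cases hh : ∃ op s, h = labelFn op s l
  · obtain ⟨op, s, rfl⟩ := hh
    have hsplit := fun j => hZc.isSplit (splitsAtArg_labelFn op s j)
    obtain ⟨b₀, hb₀⟩ := hsplit ⟨0, by have := hZc.two_le; lia⟩
    obtain ⟨s', rfl⟩ := hasRootOp_node.1 (hT.hasRootOp hb₀)
    obtain ⟨b, hb⟩ := hTc.isSplit (splitsAtArg_labelFn op s' i)
    obtain ⟨v, hv⟩ := hTc.nonempty i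
    have hvf := hTc.subset_ess i hv
    rw [hZc.ess_eq, Set.mem_iUnion] at hvf
    obtain ⟨j, hj⟩ := hvf
    refine ⟨j, ?_⟩
    by_contra hns
    -- The block would split by the same operation, against the condition on children.
    obtain ⟨b', hb'⟩ := hsplit j
    obtain ⟨p, q, hpq⟩ := hb.exists_split_left hb' (by rw [ess_xor, ess_xor]; exact ⟨v, hv, hj⟩)
      (by rwa [ess_xor, ess_xor])
    have heq : (fun x => xor ((c i).fn x) (op.sgn s')) = ((c i).negIf (op.sgn s')).fn := by
      funext x; rw [fn, fn, eval_negIf]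
    rw [heq] at hpq
    exact hT.isGoodNode.child op s' rfl i (((hT.child i).negIf _).hasRootOp hpq)
  · obtain ⟨j, hj⟩ := hZc.exists_subset_of_isBound (hZ.three_le hh)
      (fun hn => hh (hZ.isGoodNode.indecomposable hn)) (hTc.isBound i) (hTc.not_ess_subset i)
    exact ⟨j, fun v hv => hj ⟨hv, hTc.subset_ess i hv⟩⟩

end IsTreeDecomposition

end

/-! ### Uniqueness -/

namespace BoolTree

variable {V : Type}

theorem SameTree.negRoot {S T : BoolTree V} (h : SameTree S T) : SameTree S.negRoot T.negRoot := by
  cases h with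
  | leaf v s => exact .leaf v _
  | node σ g g' c c' hg hc => exact .node σ _ _ c c' (fun y => by simp [notFn, hg]) hc

theorem SameTree.negIf_left {s : Bool} {S T : BoolTree V} (h : SameTree S (T.negIf s)) :
    SameTree (S.negIf s) T := by
  cases s
  · exact h
  · simpa only [negIf_true, negRoot_negRoot] using h.negRoot

open Relation in
theorem reflTransGen_update {k : ℕ} (g : (Fin k → Bool) → Bool) (c : Fin k → BoolTree V) (i : Fin k)
    {t : BoolTree V} (h : ReflTransGen DoubleNeg (c i) t) :
    ReflTransGen DoubleNeg (node k g c) (node k g (Function.update c i t)) := by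
  induction h with
  | refl => rw [Function.update_eq_self]
  | tail _ hst ih =>
    refine ih.tail ?_
    rename_i s t _
    have := DoubleNeg.inChild g (Function.update c i s) i (t := t) (by simpa using hst)
    rwa [Function.update_idem] at this

open Relation in
/-- Chains of double-negations can be carried out in all children. -/
theorem reflTransGen_children {k : ℕ} (g : (Fin k → Bool) → Bool) {c t : Fin k → BoolTree V}
    (h : ∀ i, ReflTransGen DoubleNeg (c i) (t i)) :
    ReflTransGen DoubleNeg (node k g c) (node k g t) := by
  have key : ∀ S : Finset (Fin k), ReflTransGen DoubleNeg (node k g c)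
      (node k g fun i => if i ∈ S then t i else c i) := by
    intro S
    induction S using Finset.induction_on with
    | empty => simp only [Finset.notMem_empty, if_false]; exact .refl
    | insert a S ha ih =>
      refine ih.trans ?_
      have := reflTransGen_update g (fun i => if i ∈ S then t i else c i) a (t := t a)
        (by simpa [ha] using h a)
      convert this using 2
      funext i
      by_cases hi : i = a
      · subst hi; simp
      · simp [hi]
  simpa using key Finset.univ

open Relation in
/-- Double-negations can be applied to any set of children of the root. -/
theorem reflTransGen_negIf {k : ℕ} (g : (Fin k → Bool) → Bool) (c : Fin k → BoolTree V)
    (s : Fin k → Bool) :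
    ReflTransGen DoubleNeg (node k g c)
      (node k (fun y => g fun i => xor (y i) (s i)) fun i => (c i).negIf (s i)) := by
  have key : ∀ S : Finset (Fin k), ReflTransGen DoubleNeg (node k g c)
      (node k (fun y => g fun i => xor (y i) (decide (i ∈ S) && s i))
        fun i => (c i).negIf (decide (i ∈ S) && s i)) := by
    intro S
    induction S using Finset.induction_on with
    | empty =>
      simp only [Finset.notMem_empty, decide_false, Bool.false_and, Bool.xor_false, negIf_false]
      exact .refl
    | insert a S ha ih =>
      cases hs : s a
      · have : ∀ i, (decide (i ∈ insert a S) && s i) = (decide (i ∈ S) && s i) := by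
          intro i
          by_cases hi : i = a
          · subst hi; simp [hs]
          · simp [hi]
        simpa only [this] using ih
      · refine ih.tail ?_
        convert DoubleNeg.atRoot _ _ a using 2
        · funext y
          congr 1
          funext i
          by_cases hi : i = a
          · subst hi; simp [hs, ha]
          · simp [hi]
        · funext i
          by_cases hi : i = a
          · subst hi; simp [hs, ha, negIf]
          · simp [hi]
  simpa using key Finset.univ

end BoolTree

/-- If one block of a composition is left free and all other variables are fixed, then only the
value of the block function matters. -/
theorem IsComp.exists_factor {V : Type} [DecidableEq V] [Finite V] {k : ℕ} {f : (V → Bool) → Bool}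
    {g : (Fin k → Bool) → Bool} {c : Fin k → (V → Bool) → Bool} (h : IsComp f g c) (i : Fin k)
    (e : V → Bool) [∀ v, Decidable (v ∈ ess (c i))] :
    ∃ γ : Bool → Bool, ∀ x, f ((ess (c i)).piecewise x e) = γ (c i x) := by
  refine ⟨fun b => g (Function.update (fun j => c j e) i b), fun x => ?_⟩
  rw [h.eq]
  congr 1
  funext j
  by_cases hj : j = i
  · subst hj
    rw [Function.update_self]
    exact dependsOn_ess (c j) fun v hv => by simp [hv]
  · rw [Function.update_of_ne hj]
    exact dependsOn_ess (c j) fun v hv => by simp [Set.disjoint_left.1 (h.disj j i hj) hv]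

/-- In two compositions of the same function, the functions substituted on a common block agree up
to negation. -/
theorem IsComp.exists_eq_xor {V : Type} [DecidableEq V] [Finite V] {k l : ℕ}
    {f : (V → Bool) → Bool} {g : (Fin k → Bool) → Bool} {c : Fin k → (V → Bool) → Bool}
    {h : (Fin l → Bool) → Bool} {d : Fin l → (V → Bool) → Bool} (hc : IsComp f g c)
    (hd : IsComp f h d) {i : Fin k} {j : Fin l} (hij : ess (c i) = ess (d j)) :
    ∃ s, ∀ x, c i x = xor (d j x) s := by
  classical
  obtain ⟨v, hv⟩ := hc.nonempty i
  obtain ⟨e, he⟩ := hc.subset_ess i hv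
  obtain ⟨γ, hγ⟩ := hc.exists_factor i e
  obtain ⟨δ, hδ⟩ := hd.exists_factor j e
  have hpw : ∀ b, (ess (c i)).piecewise (Function.update e v b) e = Function.update e v b := by
    intro b
    funext w
    by_cases hw : w = v
    · subst hw; simp [hv]
    · by_cases hwc : w ∈ ess (c i) <;> simp [hw, hwc]
  rw [← hpw true, ← hpw false, hγ, hγ] at he
  have hγne : γ true ≠ γ false := by
    intro h
    have : ∀ b, γ b = γ false := fun b => by cases b <;> simp [h]
    exact he (by rw [this, ← this])
  have hγδ : ∀ x, γ (c i x) = δ (d j x) := by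
    intro x
    rw [← hγ, ← hδ]
    congr!
  obtain ⟨x₁, h₁⟩ := exists_eq_of_ess_nonempty (hc.nonempty i) true
  obtain ⟨x₀, h₀⟩ := exists_eq_of_ess_nonempty (hc.nonempty i) false
  have e₁ := hγδ x₁
  have e₀ := hγδ x₀
  rw [h₁] at e₁
  rw [h₀] at e₀
  refine ⟨d j x₀, fun x => ?_⟩
  have e := hγδ x
  revert e e₀ e₁
  cases c i x <;> cases d j x <;> cases d j x₀ <;> cases d j x₁ <;> simp <;> grind

open BoolTree in
/-- Two tree decompositions of the same function are related by double-negations. -/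
theorem exists_reflTransGen_sameTree {V : Type} [DecidableEq V] [Finite V] (T : BoolTree V) :
    ∀ (Z : BoolTree V) (f : (V → Bool) → Bool), IsTreeDecomposition T f → IsTreeDecomposition Z f →
      ∃ T', Relation.ReflTransGen DoubleNeg T T' ∧ T'.SameTree Z := by
  have hsingle : ∀ {k g f v} {c : Fin k → BoolTree V}, IsTreeDecomposition (node k g c) f →
      ess f ≠ {v} := by
    intro k g f v c h hf
    have hc := h.isComp
    set i : Fin k := ⟨0, by have := hc.two_le; lia⟩
    obtain ⟨w, hw⟩ := hc.nonempty i
    have hwf := hc.subset_ess i hw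
    refine hc.not_ess_subset i ?_
    rw [hf] at hwf ⊢
    cases hwf
    simpa using hw
  induction T with
  | leaf v s =>
    intro Z f hT hZ
    have hf : ess f = {v} := by rw [← hT.fn_eq, ess_leaf]
    cases Z with
    | leaf w s' =>
      have hf' : ess f = {w} := by rw [← hZ.fn_eq, ess_leaf]
      obtain rfl : v = w := by rw [hf] at hf'; exact Set.singleton_injective hf'
      have h0 := (hT.represents fun _ => false).trans (hZ.represents fun _ => false).symm
      simp only [eval, Bool.xor_false] at h0
      subst h0
      exact ⟨_, .refl, .leaf _ _⟩
    | node l h d => exact absurd hf (hsingle hZ)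
  | node k g c ih =>
    intro Z f hT hZ
    cases Z with
    | leaf w s =>
      exact absurd (by rw [← hZ.fn_eq, ess_leaf]) (hsingle (v := w) hT)
    | node l h d =>
      have hTc := hT.isComp
      have hZc := hZ.isComp
      choose φ hφ using hT.exists_vars_subset hZ
      choose ψ hψ using hZ.exists_vars_subset hT
      have hinv : ∀ i, ψ (φ i) = i := by
        intro i
        obtain ⟨v, hv⟩ := vars_nonempty (hT.child i).distinctVariable
        by_contra hne
        exact Set.disjoint_left.1 (hT.distinctVariable.2.2.1 _ _ hne) (hψ _ (hφ i hv)) hv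
      have hinv' : ∀ j, φ (ψ j) = j := by
        intro j
        obtain ⟨v, hv⟩ := vars_nonempty (hZ.child j).distinctVariable
        by_contra hne
        exact Set.disjoint_left.1 (hZ.distinctVariable.2.2.1 _ _ hne) (hφ _ (hψ j hv)) hv
      let σ : Fin k ≃ Fin l := ⟨φ, ψ, hinv, hinv'⟩
      obtain rfl : k = l := by simpa using Fintype.card_congr σ
      have hblock : ∀ i, ess (c i).fn = ess (d (σ i)).fn := by
        intro i
        rw [hT.isComp_vars, hZ.isComp_vars]
        refine Set.Subset.antisymm (hφ i) ?_
        have := hψ (φ i)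
        rwa [hinv] at this
      -- The children represent the same functions up to signs `s`. The children of `T` are first
      -- matched with the accordingly negated children of `Z`, then the signs are removed at the
      -- root.
      choose s hs using fun i => hTc.exists_eq_xor hZc (hblock i)
      have hsub : ∀ i, ∃ t, Relation.ReflTransGen DoubleNeg (c i) t ∧
          t.SameTree ((d (σ i)).negIf (s i)) := by
        intro i
        refine ih i _ _ (hT.child i) ?_
        have : (c i).fn = ((d (σ i)).negIf (s i)).fn := by
          funext x
          rw [hs, fn, fn, eval_negIf]
        rw [this]
        exact (hZ.child _).negIf _
      choose t ht ht' using hsub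
      refine ⟨_, (reflTransGen_children g ht).trans (reflTransGen_negIf g t s),
        .node σ _ _ _ _ (fun y => ?_) fun i => (ht' i).negIf_left⟩
      obtain ⟨x, hx⟩ := exists_forall_eq hZc.disj hZc.nonempty y
      have h1 := (hTc.eq x).symm.trans (hZc.eq x)
      simp only [hs, hx] at h1
      exact h1.symm

/-! ### Existence -/

section Existence

open BoolTree

theorem labelFn_sgn_unique {op : BoolOp} {k : ℕ} (hk : 0 < k) {s s' : Bool}
    (h : labelFn op s k = labelFn op s' k) : op.sgn s = op.sgn s' := by
  have h1 : andFn k (fun _ => true) = true := by simp [andFn]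
  have h2 : orFn k (fun _ => true) = true := by
    have : ∃ _ : Fin k, True := ⟨⟨0, hk⟩, trivial⟩
    simpa [orFn] using this
  have h3 := congrFun h fun _ => true
  cases op <;> cases s <;> cases s' <;>
    simp_all [BoolOp.sgn, labelFn_conj_false, labelFn_conj_true, labelFn_disj_false,
      labelFn_disj_true, notFn]

theorem labelFn_op_unique {op op' : BoolOp} {k : ℕ} {s s' : Bool} (hk : 2 ≤ k)
    (ha : ∀ i, DependsOnArg (labelFn op s k) i) (h : labelFn op s k = labelFn op' s' k) :
    op = op' := by
  have hc : IsComp (labelFn op s k) (labelFn op s k) (fun i (y : Fin k → Bool) => y i) := by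
    have hess : ∀ i : Fin k, ess (fun y : Fin k → Bool => y i) = {i} := fun i => by
      simpa using ess_literal i false
    exact ⟨fun x => rfl, hk, ha, fun i j hij => by simpa [hess] using hij, fun i => by simp [hess]⟩
  obtain ⟨b, hb⟩ := hc.isSplit (splitsAtArg_labelFn op s ⟨0, by lia⟩)
  obtain ⟨b', hb'⟩ := hc.isSplit (h ▸ splitsAtArg_labelFn op' s' ⟨0, by lia⟩)
  exact hb.op_unique hb'

theorem isGoodNode_labelFn {V : Type} {op : BoolOp} {s : Bool} {k : ℕ} {c : Fin k → BoolTree V}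
    (hk : 2 ≤ k) (ha : ∀ i, DependsOnArg (labelFn op s k) i)
    (hc : ∀ i, ¬ ((c i).negIf (op.sgn s)).HasRootOp op) : IsGoodNode (labelFn op s k) c := by
  refine ⟨fun _ => ⟨op, s, rfl⟩, fun op' s' h => ?_, fun h => ?_⟩
  · obtain rfl := labelFn_op_unique hk ha h
    rwa [← labelFn_sgn_unique (by lia) h]
  · rw [isAndLabel_iff, isOrLabel_iff]
    cases op
    · cases s <;> simp
    · cases s <;> simp
    · exact absurd h (not_constantButOne_labelFn_parity hk s)

variable {V : Type} [DecidableEq V]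

/-- For a composition it suffices to check that all substituted functions contribute. -/
theorem IsComp.of_subset {k : ℕ} {f : (V → Bool) → Bool} {g : (Fin k → Bool) → Bool}
    {c : Fin k → (V → Bool) → Bool} (heq : ∀ x, f x = g (fun i => c i x)) (hk : 2 ≤ k)
    (hd : ∀ i j, i ≠ j → Disjoint (ess (c i)) (ess (c j))) (hn : ∀ i, (ess (c i)).Nonempty)
    (hs : ∀ i, ess (c i) ⊆ ess f) : IsComp f g c := by
  refine ⟨heq, hk, fun i => ?_, hd, hn⟩
  obtain ⟨v, hv⟩ := hn i
  exact dependsOnArg_of_mem_ess heq (hs i hv) fun j hj =>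
    Set.disjoint_left.1 (hd i j hj.symm) hv

variable [Finite V]

theorem IsComp.isTreeDecomposition {k : ℕ} {f : (V → Bool) → Bool} {g : (Fin k → Bool) → Bool}
    {c : Fin k → BoolTree V} (h : IsComp f g fun i => (c i).fn)
    (hc : ∀ i, IsTreeDecomposition (c i) (c i).fn) (hg : IsGoodNode g c) :
    IsTreeDecomposition (node k g c) f := by
  refine isTreeDecomposition_node ⟨h.two_le, h.args, fun i j hij => ?_,
    fun i => (hc i).distinctVariable⟩ (fun x => (h.eq x).symm) hg hc
  have := h.disj i j hij
  rwa [ess_fn (hc i).distinctVariable, ess_fn (hc j).distinctVariable] at this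

theorem IsTreeDecomposition.exists_isSplit {T : BoolTree V} {f : (V → Bool) → Bool} {op : BoolOp}
    (h : IsTreeDecomposition T f) (hT : T.HasRootOp op) : ∃ a b, IsSplit op f a b := by
  obtain ⟨k, s, c, rfl⟩ := hT
  obtain ⟨b, hb⟩ := h.isComp.isSplit
    (splitsAtArg_labelFn op s (⟨0, by have := h.isComp.two_le; lia⟩ : Fin k))
  exact ⟨_, b, hb⟩

/-- If `f` splits under `op` into `a` and `b`, and `a` does not split under `op` any further, then
decompositions of `a` and `b` combine to one of `f`: the former becomes a new child of the root of
the latter if this root performs `op`, and a new root performing `op` is introduced otherwise. -/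
theorem IsSplit.exists_isTreeDecomposition {op : BoolOp} {f a b : (V → Bool) → Bool}
    (h : IsSplit op f a b) (ha : ¬ ∃ p q, IsSplit op a p q) {A B : BoolTree V}
    (hA : IsTreeDecomposition A a) (hB : IsTreeDecomposition B b) :
    ∃ T, IsTreeDecomposition T f := by
  obtain ⟨k, s, c, hk, heq, hd, hsub, hc, hroot⟩ :
      ∃ (k : ℕ) (s : Bool) (c : Fin k → BoolTree V), 1 ≤ k ∧
        (∀ x, b x = labelFn op s k fun i => (c i).fn x) ∧
        (∀ i j, i ≠ j → Disjoint (ess (c i).fn) (ess (c j).fn)) ∧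
        (∀ i, ess (c i).fn ⊆ ess b) ∧ (∀ i, IsTreeDecomposition (c i) (c i).fn) ∧
        ∀ i, ¬ ((c i).negIf (op.sgn s)).HasRootOp op := by
    by_cases hr : B.HasRootOp op
    · obtain ⟨k, s, c, rfl⟩ := hr
      have hBc := hB.isComp
      exact ⟨k, s, c, by have := hBc.two_le; lia, hBc.eq, hBc.disj, hBc.subset_ess, hB.child,
        hB.isGoodNode.child op s rfl⟩
    · have hs : op.sgn false = false := by cases op <;> rfl
      have hi : op.init false = op.ident := by cases op <;> rfl
      refine ⟨1, false, fun _ => B, le_rfl, fun x => ?_, fun i j hij => ?_, fun i => ?_,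
        fun i => ?_, fun i => ?_⟩
      · rw [labelFn, hs, hi, ← hB.represents]
        simp [BoolOp.apply_ident]
      · exact absurd (Subsingleton.elim i j) hij
      · rw [hB.fn_eq]
      · rw [hB.fn_eq]; exact hB
      · rwa [hs]
  set c' : Fin (k + 1) → BoolTree V := Fin.cons (A.negIf (op.sgn s)) c with hc'
  have hA' : ess (A.negIf (op.sgn s)).fn = ess a := by
    have : (A.negIf (op.sgn s)).fn = fun x => xor (a x) (op.sgn s) := by
      funext x; rw [fn, eval_negIf, hA.represents]
    rw [this, ess_xor]
  have hdec : ∀ i, IsTreeDecomposition (c' i) (c' i).fn := by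
    intro i
    induction i using Fin.cases with
    | zero => exact hA.negIf _
    | succ i => exact hc i
  have hcomp : IsComp f (labelFn op s (k + 1)) fun i => (c' i).fn := by
    refine .of_subset (fun x => ?_) (by lia) (fun i j hij => ?_) (fun i => ?_) (fun i => ?_)
    · have : (fun i => (c' i).fn x)
          = (Fin.cons ((A.negIf (op.sgn s)).fn x) (fun i => (c i).fn x) : Fin (k + 1) → Bool) := by
        funext i
        induction i using Fin.cases with
        | zero => rfl
        | succ i => rfl
      rw [this, labelFn_cons, ← heq, fn, eval_negIf, hA.represents, h.eq]
      simp
    · induction i using Fin.cases with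
      | zero =>
        induction j using Fin.cases with
        | zero => exact absurd rfl hij
        | succ j =>
          change Disjoint (ess (A.negIf (op.sgn s)).fn) (ess (c j).fn)
          rw [hA']
          exact h.disj.mono_right (hsub j)
      | succ i =>
        induction j using Fin.cases with
        | zero =>
          change Disjoint (ess (c i).fn) (ess (A.negIf (op.sgn s)).fn)
          rw [hA']
          exact (h.disj.mono_right (hsub i)).symm
        | succ j => exact hd i j fun h => hij (congrArg Fin.succ h)
    · rw [ess_fn (hdec i).distinctVariable]
      exact vars_nonempty (hdec i).distinctVariable
    · induction i using Fin.cases with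
      | zero => exact hA'.subset.trans h.left_subset
      | succ i => exact (hsub i).trans h.symm.left_subset
  refine ⟨_, hcomp.isTreeDecomposition hdec
    (isGoodNode_labelFn hcomp.two_le hcomp.args fun i => ?_)⟩
  induction i using Fin.cases with
  | zero =>
    have : (A.negIf (op.sgn s)).negIf (op.sgn s) = A := by
      cases op.sgn s <;> simp [negIf, negRoot_negRoot]
    change ¬ ((A.negIf (op.sgn s)).negIf (op.sgn s)).HasRootOp op
    rw [this]
    exact fun hr => ha (hA.exists_isSplit hr)
  | succ i => exact hroot i

/-- A function of at least two variables is a composition: substitute the variables themselves. -/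
theorem exists_isComp {f : (V → Bool) → Bool} (hf : 2 ≤ (ess f).ncard) :
    ∃ (k : ℕ) (g : (Fin k → Bool) → Bool) (c : Fin k → (V → Bool) → Bool), IsComp f g c := by
  classical
  have e : ess f ≃ Fin (ess f).ncard := Finite.equivFin (ess f)
  have hess : ∀ v : V, ess (fun x : V → Bool => x v) = {v} := fun v => by
    simpa using ess_literal v false
  refine ⟨_, fun y => f fun v => if hv : v ∈ ess f then y (e ⟨v, hv⟩) else false,
    fun i x => x (e.symm i), .of_subset (fun x => ?_) hf (fun i j hij => ?_) (fun i => ?_)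
    fun i => ?_⟩
  · exact dependsOn_ess f fun v hv => by simp [hv]
  · rw [hess, hess, Set.disjoint_singleton]
    exact fun h => hij (e.symm.injective (Subtype.ext h))
  · rw [hess]; exact Set.singleton_nonempty _
  · rw [hess, Set.singleton_subset_iff]; exact (e.symm i).2

/-- A nontrivial tree for the outer function of a composition yields a composition with fewer
arguments, as a child of the root that is not a leaf absorbs at least two arguments. -/
theorem IsComp.exists_lt {k : ℕ} {f : (V → Bool) → Bool} {g : (Fin k → Bool) → Bool}
    {c : Fin k → (V → Bool) → Bool} (h : IsComp f g c) (hg : HasNontrivialTree g) :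
    ∃ (k' : ℕ) (g' : (Fin k' → Bool) → Bool) (c' : Fin k' → (V → Bool) → Bool),
      IsComp f g' c' ∧ k' < k := by
  obtain ⟨U, hU, hU2, hUe⟩ := hg
  cases U with
  | leaf v s => simp [numInner] at hU2
  | node k' g' u =>
    have hUc := isComp_node hU
    have hess : ∀ i, ess (fun x => (u i).eval fun j => c j x) ⊆ ⋃ j ∈ (u i).vars, ess (c j) := by
      rintro i v ⟨x, hx⟩
      by_contra hv
      simp only [Set.mem_iUnion, not_exists] at hv
      refine hx (dependsOn_vars (u i) fun j hj => ?_)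
      rw [update_of_notMem_ess (hv j hj), update_of_notMem_ess (hv j hj)]
    refine ⟨k', g', fun i x => (u i).eval fun j => c j x,
      ⟨fun x => by rw [h.eq, ← hUe]; rfl, hUc.two_le, hUc.args, fun i j hij => ?_, fun i => ?_⟩, ?_⟩
    · refine (Set.disjoint_left.2 fun v hvi hvj => ?_ : Disjoint _ _).mono (hess i) (hess j)
      simp only [Set.mem_iUnion] at hvi hvj
      obtain ⟨p, hp, hvp⟩ := hvi
      obtain ⟨q, hq, hvq⟩ := hvj
      by_cases hpq : p = q
      · subst hpq
        exact Set.disjoint_left.1 (hU.2.2.1 i j hij) hp hq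
      · exact Set.disjoint_left.1 (h.disj p q hpq) hvp hvq
    · obtain ⟨y₁, h₁⟩ := exists_eq_of_ess_nonempty (hUc.nonempty i) true
      obtain ⟨y₀, h₀⟩ := exists_eq_of_ess_nonempty (hUc.nonempty i) false
      obtain ⟨x₁, hx₁⟩ := exists_forall_eq h.disj h.nonempty y₁
      obtain ⟨x₀, hx₀⟩ := exists_forall_eq h.disj h.nonempty y₀
      refine ess_nonempty_of_ne (x := x₁) (y := x₀) ?_
      simp only [hx₁, hx₀]
      exact fun h => by simpa using h₁.symm.trans (h.trans h₀)
    · obtain ⟨i₀, hi₀⟩ : ∃ i, (u i).numInner ≠ 0 := by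
        by_contra! hz
        simp [numInner, hz] at hU2
      obtain ⟨p, hp, q, hq, hpq⟩ : ∃ p ∈ (u i₀).vars, ∃ q ∈ (u i₀).vars, p ≠ q := by
        have hd := hU.2.2.2 i₀
        generalize u i₀ = t at hi₀ hd
        cases t with
        | leaf v s => exact absurd rfl hi₀
        | node m e w =>
          obtain ⟨p, hp⟩ := vars_nonempty (hd.2.2.2 ⟨0, by have := hd.1; lia⟩)
          obtain ⟨q, hq⟩ := vars_nonempty (hd.2.2.2 ⟨1, by have := hd.1; lia⟩)
          refine ⟨p, Set.mem_iUnion.2 ⟨_, hp⟩, q, Set.mem_iUnion.2 ⟨_, hq⟩, ?_⟩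
          rintro rfl
          exact Set.disjoint_left.1 (hd.2.2.1 _ _ (by simp)) hp hq
      choose r hr using fun i => vars_nonempty (hU.2.2.2 i)
      have huniq : ∀ {i j v}, v ∈ (u i).vars → v ∈ (u j).vars → i = j := by
        intro i j v hi hj
        by_contra hne
        exact Set.disjoint_left.1 (hU.2.2.1 i j hne) hi hj
      have hinj : Function.Injective r := fun i j hij => huniq (hr i) (hij ▸ hr j)
      obtain ⟨z, hz, hzr⟩ : ∃ z ∈ (u i₀).vars, z ≠ r i₀ := by
        by_cases hpr : p = r i₀
        · exact ⟨q, hq, fun h => hpq (hpr.trans h.symm)⟩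
        · exact ⟨p, hp, hpr⟩
      have : z ∉ Set.range r := by
        rintro ⟨i, rfl⟩
        exact hzr (by rw [huniq hz (hr i)])
      simpa using Fintype.card_lt_of_injective_of_notMem r hinj this

theorem exists_isTreeDecomposition (f : (V → Bool) → Bool) (hf : (ess f).Nonempty) :
    ∃ T, IsTreeDecomposition T f := by
  classical
  induction hN : (ess f).ncard using Nat.strong_induction_on generalizing f with
  | _ N ih =>
  subst hN
  have ih' : ∀ F, (ess F).Nonempty → ess F ⊂ ess f → ∃ T, IsTreeDecomposition T F :=
    fun F hF hs => ih _ (Set.ncard_lt_ncard hs (Set.toFinite _)) F hF rfl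
  by_cases h1 : (ess f).ncard = 1
  · obtain ⟨v, hv⟩ := Set.ncard_eq_one.1 h1
    -- `f` is the literal whose sign is the value at the zero assignment
    have hfl : f = (leaf v (f fun _ => false)).fn := by
      have hdep := dependsOn_ess f
      rw [hv] at hdep
      have hval : ∀ x, f x = f (fun _ => x v) := fun x => hdep fun w hw => by rw [hw]
      have hne : f (fun _ => true) ≠ f (fun _ => false) := by
        intro h
        have hc : ∀ x, f x = f (fun _ => false) := fun x => by
          rw [hval x]; cases x v <;> simp [h]
        obtain ⟨_, x, hx⟩ := hf
        exact hx (by rw [hc, ← hc])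
      funext x
      simp only [fn, eval]
      rw [hval x]
      revert hne
      cases x v <;> cases f (fun _ => true) <;> cases f (fun _ => false) <;> simp
    rw [hfl]
    exact ⟨_, isTreeDecomposition_leaf v _⟩
  have h2 : 2 ≤ (ess f).ncard := by
    have := (Set.ncard_pos (Set.toFinite (ess f))).2 hf
    lia
  by_cases hsplit : ∃ (op : BoolOp) (a b : (V → Bool) → Bool), IsSplit op f a b
  · obtain ⟨op, hop⟩ := hsplit
    -- Take a splitting whose first part has as few variables as possible.
    have hex : ∃ n a b, IsSplit op f a b ∧ (ess a).ncard = n := by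
      obtain ⟨a, b, hab⟩ := hop
      exact ⟨_, a, b, hab, rfl⟩
    obtain ⟨a, b, hab, hn⟩ := Nat.find_spec hex
    have hmin : ∀ {p q}, IsSplit op f p q → (ess a).ncard ≤ (ess p).ncard := fun h => by
      rw [hn]; exact Nat.find_min' hex ⟨_, _, h, rfl⟩
    have hssub : ∀ {p q}, ∀ {F : (V → Bool) → Bool}, IsSplit op F p q → ess p ⊂ ess F := by
      intro p q F h
      refine ⟨h.left_subset, fun hs => ?_⟩
      obtain ⟨v, hv⟩ := h.right
      exact Set.disjoint_right.1 h.disj hv (hs (h.symm.left_subset hv))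
    obtain ⟨A, hA⟩ := ih' a hab.left (hssub hab)
    obtain ⟨B, hB⟩ := ih' b hab.right (hssub hab.symm)
    refine hab.exists_isTreeDecomposition ?_ hA hB
    rintro ⟨p, q, hpq⟩
    exact absurd (Set.ncard_lt_ncard (hssub hpq) (Set.toFinite _))
      (not_lt.2 (hmin (hab.assoc hpq)))
  · -- Take a composition with as few arguments as possible.
    have hex := exists_isComp h2
    obtain ⟨g, c, hc⟩ := Nat.find_spec hex
    have hg : ¬ HasNontrivialTree g := by
      intro hg
      obtain ⟨k', g', c', hc', hlt⟩ := hc.exists_lt hg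
      exact Nat.find_min hex hlt ⟨g', c', hc'⟩
    have hns : ∀ op i s, ¬ SplitsAtArg op g i s := fun op i s hs =>
      hsplit ⟨op, _, hc.isSplit hs⟩
    set i₀ : Fin (Nat.find hex) := ⟨0, by have := hc.two_le; lia⟩
    choose T hT using fun i => ih' (c i) (hc.nonempty i) ⟨hc.subset_ess i, hc.not_ess_subset i⟩
    have hTc : (fun i => (T i).fn) = c := funext fun i => (hT i).fn_eq
    refine ⟨node _ g T, IsComp.isTreeDecomposition (hTc ▸ hc)
      (fun i => by rw [(hT i).fn_eq]; exact hT i) ⟨fun h => absurd h hg, ?_, fun h => ?_⟩⟩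
    · rintro op s rfl
      exact absurd (splitsAtArg_labelFn op s i₀) (hns _ _ _)
    · obtain ⟨y, hy⟩ := hc.args i₀
      obtain ⟨op, s, hs⟩ := h.exists_splitsAtArg ⟨_, _, hy⟩ i₀
      exact absurd hs (hns _ _ _)

end Existence

theorem mainTheorem1 (n : ℕ) (f : (Fin n → Bool) → Bool) (hf : Function.Surjective f) :
    (∃ T : BoolTree (Fin n), IsTreeDecomposition T f) ∧
    ∀ T Z : BoolTree (Fin n), IsTreeDecomposition T f → IsTreeDecomposition Z f →
      ∃ T' : BoolTree (Fin n),
        Relation.ReflTransGen BoolTree.DoubleNeg T T' ∧ T'.SameTree Z := by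
  obtain ⟨x, hx⟩ := hf true
  obtain ⟨y, hy⟩ := hf false
  exact ⟨exists_isTreeDecomposition f (ess_nonempty_of_ne (x := x) (y := y) (by simp [hx, hy])),
    fun T Z hT hZ => exists_reflTransGen_sameTree T Z f hT hZ⟩
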